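/- Setting. Discriminators $D_\phi:\mathbb R^n\to\mathbb R$ ($\phi\in\mathbb R^{d_\phi}$), generators $G_\theta$ ($\theta\in\mathbb R^{d_\theta}$) with latent law $p_z$, $p_{G_\theta}$ the law of $G_\theta(z)$, $z\sim p_z$, a data distribution $p$ with a density on $\mathbb R^n$, and output functions $h_1,h_2,h_3:\mathbb R\to\mathbb R$. Fix $\lambda\in\mathbb R$. The discriminator objective at step $t$ is $$V_1^t(\phi,\theta)=\mathbb E_{p}[h_1(D_\phi)]+\mathbb E_{p_{G_\theta}}[h_2(D_\phi)]-\lambda\,\mathbb E_{p_u^t}[D_\phi^2]$$ and the generator objective is $V_2(\theta,\phi)=\mathbb E_{p_z}[h_3(D_\phi(G_\theta(z)))]$; both are maximized. Here $p_u^t$, the law of the buffers of real and of old generated samples, is a mixture $a_t\,p+\sum_{j=0}^{N-1}b_{t,j}\,p_{G_{\theta_{\max(t-j,0)}}}$ with $a_t,b_{t,j}\ge 0$, $a_t+\sum_j b_{t,j}=1$ (for instance $p_u^t=p$, or equal weight on $p$ and on the mean of the last $N$ generated distributions). Alternating gradient descent with learning rate $\eta$ is $$\phi_{t+1}=\phi_t+\eta\nabla_\phi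 V_1^t(\phi_t,\theta_t)\ \ (p_u^t\text{ held fixed}),\qquad \theta_{t+1}=\theta_t+\eta\nabla_\theta V_2(\theta_t,\phi_{t+1}).$$ Put $h(\phi)=\mathbb E_p[D_\phi^2]$, $\mathcal M_\phi=\{\phi: h(\phi)=0\}$, $\mathcal M_\theta=\{\theta: p_{G_\theta}=p\}$, and, for given parameters $(\phi^*,\theta^*)$, $g(\theta)=\mathbb E_{p_{G_\theta}}[\partial_\phi D_\phi|_{\phi=\phi^*}]$. Regularity. $D$ is $C^2$ in $(\phi,x)$, $G_\theta(z)$ is $C^2$ in $\theta$ and measurable in $z$, the $h_i$ are measurable and $C^2$ near $0$, and near $(\phi^*,\theta^*)$ the integrands $h_1(D_\phi(x))$ and $D_\phi(x)^2$ (under $p$) and $h_2(D_\phi(G_\theta(z)))$, $h_3(D_\phi(G_\theta(z)))$, $D_\phi(G_\theta(z))$, $D_\phi(G_\theta(z))^2$ (under $p_z$) are almost surely $C^2$ in the parameters, with derivatives of order at most two dominated by an integrable function. Assumption 1. $p_{G_{\theta^*}}=p$, and $D_{\phi^*}=0$ on a neighbourhood of the support of $p$. Assumption 2. For some $\epsilon>0$,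 $\mathcal M_\phi\cap B_\epsilon(\phi^*)$ and $\mathcal M_\theta\cap B_\epsilon(\theta^*)$ are $C^1$ submanifolds; $\partial_v^2h(\phi^*)\ne0$ for every $v$ not tangent to $\mathcal M_\phi$ at $\phi^*$; and $\partial_w g(\theta^*)\neq0$ for every $w$ not tangent to $\mathcal M_\theta$ at $\theta^*$. Assumption 3. $h_1'(0)>0$, $h_2'(0)<0$, $h_3'(0)>0$ and $|h_1'(0)|=|h_2'(0)|=|h_3'(0)|$. Theorem. Suppose this regularity and Assumptions 1–3 hold, $\lambda>0$ and $2\lambda>h_1''(0)+h_2''(0)$. Then there is $\eta_0>0$ such that for every learning rate $\eta\in(0,\eta_0)$, every $N$ and all buffer weights, alternating gradient descent converges locally to the equilibrium: for every $\varepsilon>0$ there is $\delta>0$ such that every run with $\|\phi_0-\phi^*\|<\delta$ and $\|\theta_0-\theta^*\|<\delta$ satisfies $\|\phi_t-\phi^*\|<\varepsilon$ and $\|\theta_t-\theta^*\|<\varepsilon$ for all $t$, and $(\phi_t,\theta_t)$ converges to a point of $\mathcal M_\phi\times\mathcal M_\theta$. -/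

import Mathlib

open MeasureTheory Filter Topology
open scoped NNReal

noncomputable section

/-- A parametric GAN: discriminators `D φ : ℝⁿ → ℝ`, generators `G θ : Z → ℝⁿ`, the output
functions `h₁, h₂, h₃`, the data distribution `p` on `ℝⁿ` and the latent distribution `pz`. -/
structure ParametricGAN (dφ dθ n : ℕ) (Z : Type*) [MeasurableSpace Z] where
  D : EuclideanSpace ℝ (Fin dφ) → EuclideanSpace ℝ (Fin n) → ℝ
  G : EuclideanSpace ℝ (Fin dθ) → Z → EuclideanSpace ℝ (Fin n)
  h₁ : ℝ → ℝ
  h₂ : ℝ → ℝ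
  h₃ : ℝ → ℝ
  p : Measure (EuclideanSpace ℝ (Fin n))
  pz : Measure Z

/-- Differentiability twice under the expectation: near `x₀`, almost every `F · ω` is `C²`, and
its derivatives of order at most two have a common integrable bound. -/
def DominatedC2 {E Ω : Type*} [NormedAddCommGroup E] [NormedSpace ℝ E] [MeasurableSpace Ω]
    (μ : Measure Ω) (F : E → Ω → ℝ) (x₀ : E) : Prop :=
  ∃ r : ℝ, 0 < r ∧ (∀ x ∈ Metric.ball x₀ r, AEStronglyMeasurable (F x) μ) ∧
    ∃ K : Ω → ℝ, Integrable K μ ∧ ∀ᵐ ω ∂μ,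
      ContDiffOn ℝ 2 (fun x => F x ω) (Metric.ball x₀ r) ∧
      ∀ x ∈ Metric.ball x₀ r, ∀ k : ℕ, k ≤ 2 →
        ‖iteratedFDeriv ℝ k (fun y => F y ω) x‖ ≤ K ω

/-- `S` is an embedded `C¹` submanifold of `E` (without boundary): around each of its points a
`C¹` diffeomorphism between open sets of `E` straightens `S` to a linear subspace. -/
def IsC1Submanifold {E : Type*} [NormedAddCommGroup E] [NormedSpace ℝ E] (S : Set E) : Prop :=
  ∀ x ∈ S, ∃ (e : OpenPartialHomeomorph E E) (V : Submodule ℝ E), x ∈ e.source ∧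
    ContDiffOn ℝ 1 e e.source ∧ ContDiffOn ℝ 1 e.symm e.target ∧
    ∀ y ∈ e.source, (y ∈ S ↔ e y ∈ V)

/-- The tangent vectors of `S` at `x`: velocities at `x` of the `C¹` curves in `S`. -/
def tangentVectors {E : Type*} [NormedAddCommGroup E] [NormedSpace ℝ E] (S : Set E) (x : E) :
    Set E :=
  {v | ∃ γ : ℝ → E, γ 0 = x ∧ ContDiffAt ℝ 1 γ 0 ∧ (∀ᶠ t in 𝓝 0, γ t ∈ S) ∧ deriv γ 0 = v}

namespace ParametricGAN

variable {dφ dθ n : ℕ} {Z : Type*} [MeasurableSpace Z] (M : ParametricGAN dφ dθ n Z)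

/-- The distribution `p_{G_θ}` of the generated samples. -/
def genLaw (θ : EuclideanSpace ℝ (Fin dθ)) : Measure (EuclideanSpace ℝ (Fin n)) :=
  M.pz.map (M.G θ)

/-- The discriminator objective `E_p[h₁(D)] + E_{p_G}[h₂(D)] - lam * E_q[D²]`, to be maximized in
`φ`; `q` is the distribution over which the penalty is averaged. -/
def discObjective (lam : ℝ) (q : Measure (EuclideanSpace ℝ (Fin n)))
    (φ : EuclideanSpace ℝ (Fin dφ)) (θ : EuclideanSpace ℝ (Fin dθ)) : ℝ :=
  (∫ x, M.h₁ (M.D φ x) ∂M.p) + (∫ x, M.h₂ (M.D φ x) ∂M.genLaw θ) - lam * ∫ x, M.D φ x ^ 2 ∂q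

/-- The generator objective `E_{pz}[h₃(D(G(z)))]`, to be maximized in `θ`. -/
def genObjective (φ : EuclideanSpace ℝ (Fin dφ)) (θ : EuclideanSpace ℝ (Fin dθ)) : ℝ :=
  ∫ z, M.h₃ (M.D φ (M.G θ z)) ∂M.pz

/-- The distribution of the buffers at time `t`, which hold real samples, with total weight `a t`,
and the fake samples of the last `N` generators, that of time `t - j` with weight `b t j`
(before time `0` the generator is the initial one). -/
def bufferLaw {N : ℕ} (a : ℕ → ℝ≥0) (b : ℕ → Fin N → ℝ≥0)
    (θ : ℕ → EuclideanSpace ℝ (Fin dθ)) (t : ℕ) : Measure (EuclideanSpace ℝ (Fin n)) :=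
  a t • M.p + ∑ j : Fin N, b t j • M.genLaw (θ (t - (j : ℕ)))

/-- `(φ t, θ t)` is a run of alternating gradient descent with learning rate `η` on the
regularized objectives: first the discriminator is updated, then the generator. -/
def IsAlternatingGD (lam η : ℝ) {N : ℕ} (a : ℕ → ℝ≥0) (b : ℕ → Fin N → ℝ≥0)
    (φ : ℕ → EuclideanSpace ℝ (Fin dφ)) (θ : ℕ → EuclideanSpace ℝ (Fin dθ)) : Prop :=
  ∀ t : ℕ,
    φ (t + 1) = φ t +
      η • gradient (fun φ' => M.discObjective lam (M.bufferLaw a b θ t) φ' (θ t)) (φ t) ∧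
    θ (t + 1) = θ t + η • gradient (fun θ' => M.genObjective (φ (t + 1)) θ') (θ t)

/-- `h(φ) = E_p[D_φ²]`. -/
def discEnergy (φ : EuclideanSpace ℝ (Fin dφ)) : ℝ := ∫ x, M.D φ x ^ 2 ∂M.p

/-- The set of discriminator parameters `φ` with `h(φ) = 0`. -/
def discManifold : Set (EuclideanSpace ℝ (Fin dφ)) :=
  {φ | Integrable (fun x => M.D φ x ^ 2) M.p ∧ M.discEnergy φ = 0}

/-- The set of generator parameters `θ` with `p_{G_θ} = p`. -/
def genManifold : Set (EuclideanSpace ℝ (Fin dθ)) := {θ | M.genLaw θ = M.p}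

/-- `g(θ) = E_{p_{G_θ}}[∂_φ D_φ at φs]`. -/
def gradMean (φs : EuclideanSpace ℝ (Fin dφ)) (θ : EuclideanSpace ℝ (Fin dθ)) :
    EuclideanSpace ℝ (Fin dφ) :=
  ∫ x, gradient (fun φ => M.D φ x) φs ∂M.genLaw θ

/-- Realizability: `p_{G_θs} = p`, and `D_φs` vanishes on a neighbourhood of the support of `p`. -/
def Realizable (φs : EuclideanSpace ℝ (Fin dφ)) (θs : EuclideanSpace ℝ (Fin dθ)) : Prop :=
  M.genLaw θs = M.p ∧
    ∃ U : Set (EuclideanSpace ℝ (Fin n)), IsOpen U ∧ M.p.support ⊆ U ∧ ∀ x ∈ U, M.D φs x = 0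

/-- The equilibrium sets are `C¹` manifolds near `(φs, θs)`, and `h` and `g` are non-degenerate in
the directions that are not tangent to them. -/
def Nondegenerate (φs : EuclideanSpace ℝ (Fin dφ)) (θs : EuclideanSpace ℝ (Fin dθ)) : Prop :=
  (∃ ε : ℝ, 0 < ε ∧ IsC1Submanifold (M.discManifold ∩ Metric.ball φs ε) ∧
    IsC1Submanifold (M.genManifold ∩ Metric.ball θs ε)) ∧
  (∀ v : EuclideanSpace ℝ (Fin dφ), v ∉ tangentVectors M.discManifold φs →
    iteratedDeriv 2 (fun t : ℝ => M.discEnergy (φs + t • v)) 0 ≠ 0) ∧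
  (∀ w : EuclideanSpace ℝ (Fin dθ), w ∉ tangentVectors M.genManifold θs →
    lineDeriv ℝ (M.gradMean φs) θs w ≠ 0)

/-- The sign and equal-magnitude conditions on the derivatives of `h₁, h₂, h₃` at `0`. -/
def OutputConditions : Prop :=
  0 < deriv M.h₁ 0 ∧ deriv M.h₂ 0 < 0 ∧ 0 < deriv M.h₃ 0 ∧
    |deriv M.h₁ 0| = |deriv M.h₂ 0| ∧ |deriv M.h₂ 0| = |deriv M.h₃ 0|

/-- The standing regularity: `p` and `pz` are probability distributions, `p` has a density, the
networks are `C²`, the `hᵢ` are `C²` at `0`, and near `(φs, θs)` the expectations that occur in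
the objectives, in `h` and in `g` can be differentiated twice under the expectation. -/
structure Regular (φs : EuclideanSpace ℝ (Fin dφ)) (θs : EuclideanSpace ℝ (Fin dθ)) : Prop where
  prob_p : IsProbabilityMeasure M.p
  prob_pz : IsProbabilityMeasure M.pz
  density : M.p ≪ volume
  contDiff_D : ContDiff ℝ 2 (Function.uncurry M.D)
  contDiff_G : ∀ z, ContDiff ℝ 2 (fun θ => M.G θ z)
  measurable_G : ∀ θ, Measurable (M.G θ)
  measurable_h : Measurable M.h₁ ∧ Measurable M.h₂ ∧ Measurable M.h₃
  contDiffAt_h : ContDiffAt ℝ 2 M.h₁ 0 ∧ ContDiffAt ℝ 2 M.h₂ 0 ∧ ContDiffAt ℝ 2 M.h₃ 0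
  dom_real : DominatedC2 M.p (fun φ x => M.h₁ (M.D φ x)) φs
  dom_real_sq : DominatedC2 M.p (fun φ x => M.D φ x ^ 2) φs
  dom_fake : ∀ f ∈ ({M.h₂, M.h₃, fun u => u, fun u => u ^ 2} : Set (ℝ → ℝ)),
    DominatedC2 M.pz
      (fun (y : EuclideanSpace ℝ (Fin dφ) × EuclideanSpace ℝ (Fin dθ)) z =>
        f (M.D y.1 (M.G y.2 z))) (φs, θs)

end ParametricGAN

end

/-! Near the equilibrium the dynamics is a dissipative saddle problem in the directions normal to
the two equilibrium manifolds, and nothing happens to first order along them. Let A = E[∂_φD ⊗ ∂_φD]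
be half the Hessian of h, P the mixed second derivative of E[D_φ(G_θ(z))], c = h₁'(0) and μ = 2λ -
h₁''(0) - h₂''(0) > 0. With normal coordinates ξ for the discriminator manifold and ζ for the
generator manifold, the discriminator moves by -(μAξ + cPζ) and the generator by cP*ξ, up to the
factor η and relatively small errors.

Three facts give this form. Since h₂'(0) = -h₁'(0), the second derivatives of D in φ cancel. Since
D_φ* vanishes near the support of p, the pure θ-Hessian vanishes. For the same reason the gradient
of E[D_φ²] is 2Aξ to first order whatever generator supplies the samples, so the buffer history
enters only through the errors.

The errors must be small relative to (ξ, ζ), not merely to the distance from the equilibrium point,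
because whole manifolds of equilibria are present. The fields therefore have to vanish on the
product of the manifolds. The θ-component needs ∂_xD_φ = 0 p-almost everywhere as soon as D_φ = 0
p-almost everywhere, and here the density of p is used: a differentiable function has zero
derivative at almost every one of its zeros (`ae_fderiv_eq_zero_of_eq_zero`). Strict
differentiability and a retraction onto the manifolds then give `eventually_field_estimates`.

Nondegeneracy identifies the tangent spaces with ker A and ker P, so the linear field acts on their
orthogonal complements, where A and P*P are coercive. There |ξ|² + |ζ|² + 2τ⟨ξ, Pζ⟩ is a strict
Lyapunov function for small τ (`exists_lyapunov_saddle`): A damps ξ and the cross term damps ζ. A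
small Euler step contracts it, the alternation adding only an η² term
(`exists_contraction_of_lyapunov`, `exists_alternating_step_error`).

With buffers the errors are bounded by the maximum over a window of past times. A contraction
relative to that maximum still forces geometric decay (`tendsto_of_delayed_contraction`), so the
steps are summable, the run stays near the equilibrium and converges, and its limit has ξ = ζ = 0.
`exists_step_size_of_saddle` assembles these pieces; η₀ depends on the linear part alone and hence
not on the buffers. -/

noncomputable section

/-! ### Differentiation under the integral sign, and derivatives at zeros. -/

section Integral

set_option maxSynthPendingDepth 3

variable {E H Ω : Type*} [NormedAddCommGroup E] [NormedSpace ℝ E] [FiniteDimensional ℝ E]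
  [NormedAddCommGroup H] [NormedSpace ℝ H] [MeasurableSpace Ω] {μ : Measure Ω}

theorem aestronglyMeasurable_clm_of_apply {f : Ω → E →L[ℝ] H}
    (hf : ∀ v, AEStronglyMeasurable (fun ω => f ω v) μ) : AEStronglyMeasurable f μ := by
  set b := Module.finBasis ℝ E
  have key : f = fun ω => ∑ i, ContinuousLinearMap.smulRightL ℝ E H
      (LinearMap.toContinuousLinearMap (b.coord i)) (f ω (b i)) := by
    funext ω
    ext v
    conv_lhs => rw [← b.sum_repr v, map_sum]
    simp
  rw [key]
  refine Finset.aestronglyMeasurable_fun_sum _ fun i _ => ?_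
  exact (ContinuousLinearMap.continuous _).comp_aestronglyMeasurable (hf (b i))

/-- Each directional derivative is a pointwise limit of difference quotients along a sequence of
increments, and finitely many directions determine the derivative. -/
theorem aestronglyMeasurable_fderiv_param {F : E → Ω → H} {x : E}
    (hm : ∀ᶠ y in 𝓝 x, AEStronglyMeasurable (F y) μ)
    (hd : ∀ᵐ ω ∂μ, DifferentiableAt ℝ (fun y => F y ω) x) :
    AEStronglyMeasurable (fun ω => fderiv ℝ (fun y => F y ω) x) μ := by
  refine aestronglyMeasurable_clm_of_apply fun v => ?_
  have hc : Tendsto (fun k : ℕ => (k : ℝ) + 1) atTop atTop :=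
    tendsto_atTop_add_const_right _ _ tendsto_natCast_atTop_atTop
  have ht : Tendsto (fun k : ℕ => x + ((k : ℝ) + 1)⁻¹ • v) atTop (𝓝 x) := by
    have h0 : Tendsto (fun k : ℕ => ((k : ℝ) + 1)⁻¹) atTop (𝓝 0) := tendsto_inv_atTop_zero.comp hc
    simpa using (tendsto_const_nhds (x := x)).add (h0.smul_const v)
  obtain ⟨m, hmm⟩ := eventually_atTop.1 (ht.eventually hm)
  have hc' : Tendsto (fun k : ℕ => ((k + m : ℕ) : ℝ) + 1) atTop atTop :=
    hc.comp (tendsto_add_atTop_nat m)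
  refine aestronglyMeasurable_of_tendsto_ae atTop
    (f := fun (k : ℕ) ω => (((k + m : ℕ) : ℝ) + 1) •
      (F (x + (((k + m : ℕ) : ℝ) + 1)⁻¹ • v) ω - F x ω)) (fun k => ?_) ?_
  · exact ((hmm (k + m) (by omega)).sub hm.self_of_nhds).const_smul _
  · filter_upwards [hd] with ω hω
    exact hω.hasFDerivAt.lim v (tendsto_norm_atTop_atTop.comp hc')

/-- Differentiation under the integral sign to second order. -/
theorem DominatedC2.exists_ball {F : E → Ω → ℝ} {x₀ : E} (h : DominatedC2 μ F x₀) :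
    ∃ r > 0, (∀ x ∈ Metric.ball x₀ r, Integrable (F x) μ) ∧
      (∀ᵐ ω ∂μ, ContDiffOn ℝ 2 (fun x => F x ω) (Metric.ball x₀ r)) ∧
      (∀ x ∈ Metric.ball x₀ r, Integrable (fun ω => fderiv ℝ (fun y => F y ω) x) μ) ∧
      (∀ x ∈ Metric.ball x₀ r, HasFDerivAt (fun x => ∫ ω, F x ω ∂μ)
        (∫ ω, fderiv ℝ (fun y => F y ω) x ∂μ) x) ∧
      (∀ x ∈ Metric.ball x₀ r, Integrable (fun ω => fderiv ℝ (fderiv ℝ (fun y => F y ω)) x) μ) ∧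
      (∀ x ∈ Metric.ball x₀ r, HasFDerivAt (fun x => ∫ ω, fderiv ℝ (fun y => F y ω) x ∂μ)
        (∫ ω, fderiv ℝ (fderiv ℝ (fun y => F y ω)) x ∂μ) x) ∧
      ContDiffAt ℝ 2 (fun x => ∫ ω, F x ω ∂μ) x₀ := by
  obtain ⟨r, hr, hm, K, hK, hae⟩ := h
  have hC : ∀ᵐ ω ∂μ, ∀ x ∈ Metric.ball x₀ r, ContDiffAt ℝ 2 (fun x => F x ω) x := by
    filter_upwards [hae] with ω hω x hx
    exact hω.1.contDiffAt (Metric.isOpen_ball.mem_nhds hx)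
  have hC1 : ∀ᵐ ω ∂μ, ∀ x ∈ Metric.ball x₀ r, ContDiffAt ℝ 1 (fderiv ℝ (fun x => F x ω)) x := by
    filter_upwards [hC] with ω hω x hx
    exact (hω x hx).fderiv_right (by norm_num)
  have hC0 : ∀ᵐ ω ∂μ, ∀ x ∈ Metric.ball x₀ r,
      ContinuousAt (fderiv ℝ (fderiv ℝ (fun x => F x ω))) x := by
    filter_upwards [hC1] with ω hω x hx
    exact ((hω x hx).fderiv_right (m := 0) (by norm_num)).continuousAt
  have hb : ∀ᵐ ω ∂μ, ∀ x ∈ Metric.ball x₀ r, ‖F x ω‖ ≤ K ω ∧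
      ‖fderiv ℝ (fun y => F y ω) x‖ ≤ K ω ∧ ‖fderiv ℝ (fderiv ℝ (fun y => F y ω)) x‖ ≤ K ω := by
    filter_upwards [hae] with ω hω x hx
    refine ⟨?_, ?_, ?_⟩
    · simpa using hω.2 x hx 0 (by norm_num)
    · have := hω.2 x hx 1 (by norm_num)
      rwa [norm_iteratedFDeriv_one] at this
    · have := hω.2 x hx 2 (by norm_num)
      rwa [← norm_iteratedFDeriv_fderiv, norm_iteratedFDeriv_one] at this
  have hmn : ∀ x ∈ Metric.ball x₀ r, ∀ᶠ y in 𝓝 x, AEStronglyMeasurable (F y) μ := fun x hx => by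
    filter_upwards [Metric.isOpen_ball.mem_nhds hx] with y hy using hm y hy
  have hm1 : ∀ x ∈ Metric.ball x₀ r,
      AEStronglyMeasurable (fun ω => fderiv ℝ (fun y => F y ω) x) μ := fun x hx =>
    aestronglyMeasurable_fderiv_param (hmn x hx)
      (hC.mono fun ω hω => (hω x hx).differentiableAt (by norm_num))
  have hm1n : ∀ x ∈ Metric.ball x₀ r, ∀ᶠ y in 𝓝 x,
      AEStronglyMeasurable (fun ω => fderiv ℝ (fun y => F y ω) y) μ := fun x hx => by
    filter_upwards [Metric.isOpen_ball.mem_nhds hx] with y hy using hm1 y hy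
  have hm2 : ∀ x ∈ Metric.ball x₀ r,
      AEStronglyMeasurable (fun ω => fderiv ℝ (fderiv ℝ (fun y => F y ω)) x) μ := fun x hx =>
    aestronglyMeasurable_fderiv_param (F := fun x ω => fderiv ℝ (fun y => F y ω) x) (hm1n x hx)
      (hC1.mono fun ω hω => (hω x hx).differentiableAt (by norm_num))
  have hi0 : ∀ x ∈ Metric.ball x₀ r, Integrable (F x) μ := fun x hx =>
    hK.mono' (hm x hx) (hb.mono fun ω hω => (hω x hx).1)
  have hi1 : ∀ x ∈ Metric.ball x₀ r, Integrable (fun ω => fderiv ℝ (fun y => F y ω) x) μ :=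
    fun x hx => hK.mono' (hm1 x hx) (hb.mono fun ω hω => (hω x hx).2.1)
  have hi2 : ∀ x ∈ Metric.ball x₀ r,
      Integrable (fun ω => fderiv ℝ (fderiv ℝ (fun y => F y ω)) x) μ :=
    fun x hx => hK.mono' (hm2 x hx) (hb.mono fun ω hω => (hω x hx).2.2)
  have hd1 : ∀ x ∈ Metric.ball x₀ r, HasFDerivAt (fun x => ∫ ω, F x ω ∂μ)
      (∫ ω, fderiv ℝ (fun y => F y ω) x ∂μ) x := fun x hx =>
    hasFDerivAt_integral_of_dominated_of_fderiv_le (Metric.isOpen_ball.mem_nhds hx) (hmn x hx)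
      (hi0 x hx) (hm1 x hx) (hb.mono fun ω hω y hy => (hω y hy).2.1) hK
      (hC.mono fun ω hω y hy => ((hω y hy).differentiableAt (by norm_num)).hasFDerivAt)
  have hd2 : ∀ x ∈ Metric.ball x₀ r, HasFDerivAt (fun x => ∫ ω, fderiv ℝ (fun y => F y ω) x ∂μ)
        (∫ ω, fderiv ℝ (fderiv ℝ (fun y => F y ω)) x ∂μ) x := fun x hx =>
    hasFDerivAt_integral_of_dominated_of_fderiv_le (Metric.isOpen_ball.mem_nhds hx) (hm1n x hx)
      (hi1 x hx) (hm2 x hx) (hb.mono fun ω hω y hy => (hω y hy).2.2) hK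
      (hC1.mono fun ω hω y hy => ((hω y hy).differentiableAt (by norm_num)).hasFDerivAt)
  have hcont : ContinuousOn (fun x => ∫ ω, fderiv ℝ (fderiv ℝ (fun y => F y ω)) x ∂μ)
      (Metric.ball x₀ r) := fun x hx => by
    refine ContinuousAt.continuousWithinAt (continuousAt_of_dominated (bound := K) ?_ ?_ hK ?_)
    · filter_upwards [Metric.isOpen_ball.mem_nhds hx] with y hy using hm2 y hy
    · filter_upwards [Metric.isOpen_ball.mem_nhds hx] with y hy
      exact hb.mono fun ω hω => (hω y hy).2.2
    · exact hC0.mono fun ω hω => hω x hx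
  have hball := Metric.isOpen_ball.mem_nhds (Metric.mem_ball_self (x := x₀) hr)
  refine ⟨r, hr, hi0, hae.mono fun ω hω => hω.1, hi1, hd1, hi2, hd2, ?_⟩
  refine (contDiffAt_succ_iff_hasFDerivAt (n := 1)).2 ⟨_, ⟨_, hball, hd1⟩, ?_⟩
  exact contDiffAt_one_iff.2 ⟨_, _, hball, hcont, hd2⟩

/-- A real function on `E` has vanishing derivative at almost every zero. -/
theorem ae_fderiv_eq_zero_of_eq_zero [MeasurableSpace E] [BorelSpace E] (ν : Measure E)
    [ν.IsAddHaarMeasure] {f : E → ℝ} (hf : Differentiable ℝ f) :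
    ∀ᵐ x ∂ν, f x = 0 → fderiv ℝ f x = 0 := by
  rcases subsingleton_or_nontrivial E with hE | hE
  · exact Eventually.of_forall fun x _ => by ext v; simp [Subsingleton.elim v 0]
  obtain ⟨v, hv⟩ := exists_ne (0 : E)
  set s := {x | f x = 0}
  have hs : MeasurableSet s := (isClosed_eq hf.continuous continuous_const).measurableSet
  -- The almost everywhere bound `norm_fderiv_sub_le` is about self-maps of `E`, hence the factor
  -- `v`. On the zero set the map is constant, so the zero map approximates it with constant 0.
  have hA : ApproximatesLinearOn (fun x => f x • v) (0 : E →L[ℝ] E) s 0 := by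
    intro x hx y hy
    have hx : f x = 0 := hx
    have hy : f y = 0 := hy
    simp [hx, hy]
  have := hA.norm_fderiv_sub_le ν hs (fun x => (fderiv ℝ f x).smulRight v) fun x _ =>
    ((hf x).hasFDerivAt.smul_const v).hasFDerivWithinAt
  rw [ae_restrict_iff' hs] at this
  filter_upwards [this] with x hx h0
  have h1 := hx h0
  simp only [sub_zero, nonpos_iff_eq_zero, nnnorm_eq_zero] at h1
  ext w
  have := congrArg (fun L => L w) h1
  simpa [hv] using this

end Integral

/-! ### Charts, tangent spaces and normal coordinates of C¹ submanifolds. -/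

section Straighten

open Asymptotics

variable {E : Type*} [NormedAddCommGroup E] [InnerProductSpace ℝ E] [FiniteDimensional ℝ E]

/-- A chart of a `C¹` submanifold has an invertible derivative, which maps the tangent space onto
the model subspace. -/
theorem IsC1Submanifold.exists_chart {S : Set E} {x₀ : E} {ε : ℝ} (hε : 0 < ε)
    (hS : IsC1Submanifold (S ∩ Metric.ball x₀ ε)) (hx : x₀ ∈ S) (T : Submodule ℝ E)
    (hT : ∀ v, v ∈ tangentVectors S x₀ ↔ v ∈ T) :
    ∃ (e : OpenPartialHomeomorph E E) (L : E ≃L[ℝ] E), x₀ ∈ e.source ∧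
      HasStrictFDerivAt e (L : E →L[ℝ] E) x₀ ∧
      L.symm (e x₀) ∈ T ∧ (∀ᶠ y in 𝓝 x₀, (y ∈ S ↔ L.symm (e y) ∈ T)) := by
  have hball := Metric.isOpen_ball.mem_nhds (Metric.mem_ball_self (x := x₀) hε)
  obtain ⟨e, V, hxs, hc, hcs, hV⟩ := hS x₀ ⟨hx, Metric.mem_ball_self hε⟩
  have hsrc := e.open_source.mem_nhds hxs
  have hxt : e x₀ ∈ e.target := e.map_source hxs
  have htgt := e.open_target.mem_nhds hxt
  have he : ContDiffAt ℝ 1 e x₀ := hc.contDiffAt hsrc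
  have hes : ContDiffAt ℝ 1 e.symm (e x₀) := hcs.contDiffAt htgt
  have h1 := (he.hasStrictFDerivAt one_ne_zero)
  have h2 := (hes.hasStrictFDerivAt one_ne_zero)
  have hid : (fderiv ℝ e.symm (e x₀)).comp (fderiv ℝ e x₀) = ContinuousLinearMap.id ℝ E := by
    have h3 := (h2.comp x₀ h1).hasFDerivAt
    refine h3.unique ((hasFDerivAt_id x₀).congr_of_eventuallyEq ?_)
    filter_upwards [hsrc] with y hy
    simp [e.left_inv hy]
  have hinj : Function.Injective (fderiv ℝ e x₀ : E →ₗ[ℝ] E) := by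
    intro v w hvw
    have := congrArg (fderiv ℝ e.symm (e x₀)) hvw
    have h4 := fun u => congrArg (fun l : E →L[ℝ] E => l u) hid
    simp only [ContinuousLinearMap.comp_apply, ContinuousLinearMap.id_apply] at h4
    simpa [h4] using this
  set L : E ≃L[ℝ] E := (LinearEquiv.ofInjectiveEndo _ hinj).toContinuousLinearEquiv
  have hL : (L : E →L[ℝ] E) = fderiv ℝ e x₀ := by ext v; rfl
  rw [← hL] at h1
  have h1s : HasStrictFDerivAt e.symm (L.symm : E →L[ℝ] E) (e x₀) :=
    e.hasStrictFDerivAt_symm hxt (by rwa [e.left_inv hxs])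
  have hST : ∀ᶠ y in 𝓝 x₀, (y ∈ S ↔ e y ∈ V) := by
    filter_upwards [hsrc, hball] with y hy hyb
    rw [← hV y hy]
    exact ⟨fun h => ⟨h, hyb⟩, fun h => h.1⟩
  have hTV : ∀ v, v ∈ T ↔ L v ∈ V := by
    intro v
    rw [← hT]
    constructor
    · rintro ⟨γ, h0, hγ, hγS, rfl⟩
      have hd : HasDerivAt γ (deriv γ 0) 0 := (hγ.differentiableAt one_ne_zero).hasDerivAt
      -- In the chart the curve lies in `V`, so its component orthogonal to `V` is constantly zero
      -- and has zero velocity.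
      have hd2 : HasDerivAt (fun t => Vᗮ.starProjection (e (γ t)))
          (Vᗮ.starProjection (L (deriv γ 0))) 0 := by
        rw [← h0] at h1
        have := h1.hasFDerivAt.comp_hasDerivAt (0 : ℝ) hd
        exact (Vᗮ.starProjection.hasFDerivAt).comp_hasDerivAt (0 : ℝ) this
      have hd3 : HasDerivAt (fun t => Vᗮ.starProjection (e (γ t))) 0 0 := by
        refine (hasDerivAt_const (0 : ℝ) (0 : E)).congr_of_eventuallyEq ?_
        have hcont : Tendsto γ (𝓝 0) (𝓝 x₀) := h0 ▸ hγ.continuousAt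
        filter_upwards [hγS, hcont.eventually hST] with t ht hts
        have : e (γ t) ∈ V := hts.1 ht
        rw [Submodule.starProjection_apply_eq_zero_iff, Submodule.orthogonal_orthogonal]
        exact this
      have := hd2.unique hd3
      rwa [Submodule.starProjection_apply_eq_zero_iff, Submodule.orthogonal_orthogonal] at this
    · intro hv
      have hline : ContDiff ℝ 1 (fun t : ℝ => e x₀ + t • L v) :=
        contDiff_const.add (contDiff_id.smul contDiff_const)
      have hl0 : e x₀ + (0 : ℝ) • L v = e x₀ := by simp
      have hlt : Tendsto (fun t : ℝ => e x₀ + t • L v) (𝓝 0) (𝓝 (e x₀)) := by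
        have := hline.continuous.tendsto 0
        rwa [hl0] at this
      refine ⟨fun t => e.symm (e x₀ + t • L v), by simp [e.left_inv hxs], ?_, ?_, ?_⟩
      · refine ContDiffAt.comp (0 : ℝ) ?_ hline.contDiffAt
        rw [hl0]
        exact hes
      · have hst : Tendsto (fun t : ℝ => e.symm (e x₀ + t • L v)) (𝓝 0) (𝓝 x₀) := by
          have := hes.continuousAt.tendsto.comp hlt
          rwa [e.left_inv hxs] at this
        filter_upwards [hlt.eventually htgt, hst.eventually hST] with t ht hts
        rw [hts, e.right_inv ht]
        exact V.add_mem (hST.self_of_nhds.1 hx) (V.smul_mem _ hv)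
      · have hd : HasDerivAt (fun t : ℝ => e x₀ + t • L v) (L v) 0 := by
          simpa using ((hasDerivAt_id (0 : ℝ)).smul_const (L v)).const_add (e x₀)
        have h1s' : HasFDerivAt e.symm (L.symm : E →L[ℝ] E) (e x₀ + (0 : ℝ) • L v) := by
          rw [hl0]; exact h1s.hasFDerivAt
        have := (h1s'.comp_hasDerivAt (0 : ℝ) hd).deriv
        exact this.trans (by simp)
  refine ⟨e, L, hxs, h1, ?_, ?_⟩
  · rw [hTV, L.apply_symm_apply]
    exact hST.self_of_nhds.1 hx
  · filter_upwards [hST] with y hy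
    rw [hTV, L.apply_symm_apply, hy]

/-- A normal coordinate `ξ` and a retraction `ρ` for a `C¹` submanifold `S` near `x₀`. -/
theorem IsC1Submanifold.exists_normal_coordinate {S : Set E} {x₀ : E} {ε : ℝ} (hε : 0 < ε)
    (hS : IsC1Submanifold (S ∩ Metric.ball x₀ ε)) (hx : x₀ ∈ S) (T : Submodule ℝ E)
    (hT : ∀ v, v ∈ tangentVectors S x₀ ↔ v ∈ T) :
    ∃ ξ ρ : E → E, (∀ x, ξ x ∈ Tᗮ) ∧ HasStrictFDerivAt ξ Tᗮ.starProjection x₀ ∧ ξ x₀ = 0 ∧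
      (∀ᶠ x in 𝓝 x₀, ContinuousAt ξ x) ∧ Tendsto ρ (𝓝 x₀) (𝓝 x₀) ∧ (∀ᶠ x in 𝓝 x₀, ρ x ∈ S) ∧
      (fun x => x - ρ x - ξ x) =o[𝓝 x₀] ξ ∧ (∀ᶠ x in 𝓝 x₀, ξ x = 0 → x ∈ S) := by
  obtain ⟨e, L, hxs, h1, hT0, hST⟩ := hS.exists_chart hε hx T hT
  have hsrc := e.open_source.mem_nhds hxs
  have hxt : e x₀ ∈ e.target := e.map_source hxs
  have htgt := e.open_target.mem_nhds hxt
  have h1s : HasStrictFDerivAt e.symm (L.symm : E →L[ℝ] E) (e x₀) :=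
    e.hasStrictFDerivAt_symm hxt (by rwa [e.left_inv hxs])
  -- Composing the chart with the inverse of its derivative makes the derivative at `x₀` the
  -- identity and the model subspace `T` itself. The normal coordinate is the `Tᗮ`-part of `q`; the
  -- retraction drops that part and returns by `ψ`.
  set q : E → E := fun x => L.symm (e x)
  set ψ : E → E := fun y => e.symm (L y)
  have hq : HasStrictFDerivAt q (ContinuousLinearMap.id ℝ E) x₀ := by
    have := L.symm.hasStrictFDerivAt.comp x₀ h1
    convert this using 1
    ext v; simp
  have hψ : HasStrictFDerivAt ψ (ContinuousLinearMap.id ℝ E) (q x₀) := by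
    have h2 : HasStrictFDerivAt e.symm (L.symm : E →L[ℝ] E) (L (q x₀)) := by
      simpa [q] using h1s
    have := h2.comp (q x₀) L.hasStrictFDerivAt
    convert this using 1
    ext v; simp
  have hq0 : q x₀ ∈ T := hT0
  have hqc : Tendsto q (𝓝 x₀) (𝓝 (q x₀)) := hq.continuousAt
  have hp0 : T.starProjection (q x₀) = q x₀ := Submodule.starProjection_eq_self_iff.2 hq0
  have hpc : Tendsto (fun x => T.starProjection (q x)) (𝓝 x₀) (𝓝 (q x₀)) := by
    have := (T.starProjection.continuous.tendsto (q x₀)).comp hqc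
    rwa [hp0] at this
  have hsplit : ∀ x, q x - T.starProjection (q x) = Tᗮ.starProjection (q x) := fun x => by
    rw [sub_eq_iff_eq_add', Submodule.starProjection_add_starProjection_orthogonal]
  have hψ0 : ψ (q x₀) = x₀ := by simp [ψ, q, e.left_inv hxs]
  have hρ : Tendsto (fun x => ψ (T.starProjection (q x))) (𝓝 x₀) (𝓝 x₀) := by
    have := hψ.continuousAt.tendsto.comp hpc
    rwa [hψ0] at this
  refine ⟨fun x => Tᗮ.starProjection (q x), fun x => ψ (T.starProjection (q x)),
    fun x => Submodule.starProjection_apply_mem _ _, ?_, ?_, ?_, hρ, ?_, ?_, ?_⟩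
  · simpa using Tᗮ.starProjection.hasStrictFDerivAt.comp x₀ hq
  · show Tᗮ.starProjection (q x₀) = 0
    rw [Submodule.starProjection_apply_eq_zero_iff, Submodule.orthogonal_orthogonal]
    exact hq0
  · filter_upwards [hsrc] with x hx
    exact Tᗮ.starProjection.continuous.continuousAt.comp
      (L.symm.continuous.continuousAt.comp (e.continuousAt hx))
  · have hLp : Tendsto (fun x => L (T.starProjection (q x))) (𝓝 x₀) (𝓝 (e x₀)) := by
      have := (L.continuous.tendsto (q x₀)).comp hpc
      simpa [q, Function.comp_def] using this
    filter_upwards [hLp.eventually htgt, hρ.eventually hST] with x hx hxS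
    rw [hxS]
    simp only [ψ]
    rw [e.right_inv hx, L.symm_apply_apply]
    exact Submodule.starProjection_apply_mem _ _
  -- Strict differentiability of `ψ` is applied to the pair `q x` and its projection to `T`, whose
  -- difference is exactly the normal coordinate; this makes the error relative to `ξ x`.
  · have h3 := hψ.isLittleO.comp_tendsto (hqc.prodMk_nhds hpc)
    refine (h3.congr' ?_ ?_)
    · filter_upwards [hsrc] with x hx
      have : ψ (q x) = x := by simp only [ψ, q, L.apply_symm_apply, e.left_inv hx]
      show ψ (q x) - ψ (T.starProjection (q x)) - (q x - T.starProjection (q x)) = _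
      rw [this, hsplit]
    · filter_upwards with x
      exact hsplit x
  · filter_upwards [hST] with x hx h0
    rw [hx]
    rwa [Submodule.starProjection_apply_eq_zero_iff, Submodule.orthogonal_orthogonal] at h0

end Straighten

/-! ### One explicit step contracts a quadratic Lyapunov function. -/

section Lyapunov

set_option maxSynthPendingDepth 3

set_option maxHeartbeats 1000000 in
/-- One step of a perturbed Euler-type scheme contracts the quadratic form `B` of a strict Lyapunov
function of the linear field `J`, if the step size is small. -/
theorem exists_contraction_of_lyapunov {H : Type*} [NormedAddCommGroup H] [NormedSpace ℝ H]
    (B : H →L[ℝ] H →L[ℝ] ℝ) (hB : ∀ x y, B x y = B y x) (J R : H →L[ℝ] H) (S : Set H) {m κ : ℝ}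
    (hm : 0 < m) (hκ : 0 < κ) (hBm : ∀ x ∈ S, m * ‖x‖ ^ 2 ≤ B x x)
    (hJ : ∀ x ∈ S, B x (J x) ≤ -κ * ‖x‖ ^ 2) :
    ∃ η₀ : ℝ, 0 < η₀ ∧ η₀ ≤ 1 ∧ ∀ η : ℝ, 0 < η → η < η₀ → ∃ ε : ℝ, 0 < ε ∧ ∃ ρ : ℝ, 0 < ρ ∧ ρ < 1 ∧
      ∀ x ∈ S, ∀ (x' : H) (h : ℝ), 0 ≤ h → B x x ≤ m * h ^ 2 →
        ‖x' - (x + η • J x + η ^ 2 • R x)‖ ≤ ε * h → B x' x' ≤ ρ * (m * h ^ 2) := by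
  -- Besides bounding `B`, the constant exceeds `κ`, which keeps the contraction factors below
  -- nonnegative.
  set b : ℝ := ‖B‖ + κ + 1
  have hb : 0 < b := by positivity
  have hBb : ∀ x y, |B x y| ≤ b * (‖x‖ * ‖y‖) := fun x y => by
    have h1 := B.le_opNorm₂ x y
    rw [Real.norm_eq_abs, mul_assoc] at h1
    refine h1.trans (mul_le_mul_of_nonneg_right ?_ (by positivity))
    simp only [b]; linarith
  set j := ‖J‖
  set s := ‖R‖
  have hj : 0 ≤ j := norm_nonneg _
  have hs : 0 ≤ s := norm_nonneg _
  set C : ℝ := b * (2 * s + (j + s) ^ 2) + 1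
  have hC : 0 < C := by positivity
  set g : ℝ := 1 + j + s
  have hg : 0 < g := by positivity
  -- `C` bounds the coefficient of `η ^ 2`, so for `η * C < κ` the second order term costs at most
  -- half of the first order gain `2 * η * κ * ‖x‖ ^ 2`.
  refine ⟨min 1 (κ / C), by positivity, min_le_left _ _, fun η hη hη0 => ?_⟩
  have hη1 : η < 1 := hη0.trans_le (min_le_left _ _)
  have hηC : η * C < κ := by
    have := hη0.trans_le (min_le_right _ _)
    rwa [lt_div_iff₀ hC] at this
  have hb' : 0 < b * (2 * g + 1) := by positivity
  -- The error `e` changes the form by at most `ε * b * (2 * g + 1) * h ^ 2`. This `ε` lets it use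
  -- up half of the remaining gain `η * κ / b`, which leaves the factor `1 - η * κ / (2 * b)`.
  refine ⟨min 1 (η * κ * m / (2 * b) / (b * (2 * g + 1))), by positivity,
    1 - η * κ / (2 * b), ?_, ?_, ?_⟩
  · have : η * κ / (2 * b) < 1 := by
      rw [div_lt_one (by positivity)]
      have h1 : η * κ < 1 * κ := mul_lt_mul_of_pos_right hη1 hκ
      have h2 : 0 ≤ ‖B‖ := norm_nonneg B
      simp only [b]; linarith
    linarith
  · have : 0 < η * κ / (2 * b) := by positivity
    linarith
  intro x hx x' h hh hxh hx'
  set ε : ℝ := min 1 (η * κ * m / (2 * b) / (b * (2 * g + 1)))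
  have hε1 : ε ≤ 1 := min_le_left _ _
  have hε2 : ε * (b * (2 * g + 1)) ≤ η * κ * m / (2 * b) := by
    rw [← le_div_iff₀ hb']
    exact min_le_right _ _
  have hε0 : 0 ≤ ε := by positivity
  have hxn : ‖x‖ ≤ h := by
    have h1 := (hBm x hx).trans hxh
    have h2 := le_of_mul_le_mul_left h1 hm
    exact (sq_le_sq₀ (norm_nonneg _) hh).1 h2
  set w : H := J x + η • R x
  set y : H := x + η • J x + η ^ 2 • R x
  have hyw : y = x + η • w := by simp only [y, w]; module
  have hJx : ‖J x‖ ≤ j * ‖x‖ := J.le_opNorm x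
  have hRx : ‖R x‖ ≤ s * ‖x‖ := R.le_opNorm x
  have hx0 : 0 ≤ ‖x‖ := norm_nonneg x
  have hw : ‖w‖ ≤ (j + s) * ‖x‖ := by
    calc ‖w‖ ≤ ‖J x‖ + ‖η • R x‖ := norm_add_le _ _
      _ = ‖J x‖ + η * ‖R x‖ := by rw [norm_smul, Real.norm_of_nonneg hη.le]
      _ ≤ j * ‖x‖ + 1 * (s * ‖x‖) := by gcongr
      _ = (j + s) * ‖x‖ := by ring
  have hy : ‖y‖ ≤ g * h := by
    rw [hyw]
    calc ‖x + η • w‖ ≤ ‖x‖ + ‖η • w‖ := norm_add_le _ _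
      _ = ‖x‖ + η * ‖w‖ := by rw [norm_smul, Real.norm_of_nonneg hη.le]
      _ ≤ ‖x‖ + 1 * ((j + s) * ‖x‖) := by gcongr
      _ = g * ‖x‖ := by simp only [g]; ring
      _ ≤ g * h := by gcongr
  have hByy : B y y = B x x + 2 * η * B x (J x) + η ^ 2 * (2 * B x (R x) + B w w) := by
    have h1 : B y y = B x x + 2 * η * B x w + η ^ 2 * B w w := by
      rw [hyw]
      simp only [map_add, map_smul, add_apply, smul_apply,
        smul_eq_mul, hB w x]
      ring
    have h2 : B x w = B x (J x) + η * B x (R x) := by simp [w]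
    rw [h1, h2]; ring
  have hrest : 2 * B x (R x) + B w w ≤ C * ‖x‖ ^ 2 := by
    have h1 : B x (R x) ≤ b * (‖x‖ * (s * ‖x‖)) :=
      (le_abs_self _).trans ((hBb _ _).trans (by gcongr))
    have h2 : B w w ≤ b * (((j + s) * ‖x‖) * ((j + s) * ‖x‖)) :=
      (le_abs_self _).trans ((hBb _ _).trans (by gcongr))
    have h3 : 0 ≤ ‖x‖ ^ 2 := by positivity
    simp only [C]
    nlinarith
  have hdec : B y y ≤ B x x - η * κ * ‖x‖ ^ 2 := by
    rw [hByy]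
    have h1 := mul_le_mul_of_nonneg_left (hJ x hx) (show 0 ≤ 2 * η by positivity)
    have h2 := mul_le_mul_of_nonneg_left hrest (show 0 ≤ η ^ 2 by positivity)
    have h3 : η ^ 2 * (C * ‖x‖ ^ 2) ≤ η * κ * ‖x‖ ^ 2 := by
      have : η * (η * C) ≤ η * κ := by gcongr
      nlinarith [sq_nonneg ‖x‖]
    linarith
  have hxb : B x x ≤ b * ‖x‖ ^ 2 := (le_abs_self _).trans ((hBb x x).trans (by rw [sq]))
  have hdec2 : B y y ≤ (1 - η * κ / b) * (m * h ^ 2) := by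
    have h1 : η * κ / b * B x x ≤ η * κ * ‖x‖ ^ 2 := by
      calc η * κ / b * B x x ≤ η * κ / b * (b * ‖x‖ ^ 2) := by gcongr
        _ = η * κ * ‖x‖ ^ 2 := by field_simp
    have h2 : B y y ≤ (1 - η * κ / b) * B x x := by linarith
    refine h2.trans (mul_le_mul_of_nonneg_left hxh ?_)
    have : η * κ / b ≤ 1 := by
      rw [div_le_one hb]
      have h1 : η * κ < 1 * κ := mul_lt_mul_of_pos_right hη1 hκ
      have h2 : 0 ≤ ‖B‖ := norm_nonneg B
      simp only [b]; linarith
    linarith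
  set e : H := x' - y
  have hx'e : x' = y + e := by simp [e]
  have hBx' : B x' x' = B y y + 2 * B y e + B e e := by
    rw [hx'e]
    simp only [map_add, add_apply, hB e y]
    ring
  have h1 : B y e ≤ b * ((g * h) * (ε * h)) := (le_abs_self _).trans ((hBb _ _).trans (by gcongr))
  have h2 : B e e ≤ b * ((1 * h) * (ε * h)) := by
    refine (le_abs_self _).trans ((hBb _ _).trans ?_)
    have : ‖e‖ ≤ 1 * h := hx'.trans (by gcongr)
    gcongr
  have h3 : ε * (b * (2 * g + 1)) * h ^ 2 ≤ η * κ * m / (2 * b) * h ^ 2 := by gcongr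
  have h4 : (1 - η * κ / b) * (m * h ^ 2) + η * κ * m / (2 * b) * h ^ 2 =
      (1 - η * κ / (2 * b)) * (m * h ^ 2) := by
    field_simp
    ring
  rw [← h4, hBx']
  nlinarith

end Lyapunov

/-! ### Coercivity and the Lyapunov function of the linear saddle problem. -/

section Coercive

open scoped InnerProductSpace

/-- The quadratic form attains a minimum on the compact unit sphere of `K`, and homogeneity does the
rest; if the sphere is empty any constant works. -/
theorem exists_coercive_of_pos {E : Type*} [NormedAddCommGroup E] [InnerProductSpace ℝ E]
    [FiniteDimensional ℝ E] (A : E →L[ℝ] E) (K : Submodule ℝ E)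
    (hA : ∀ x ∈ K, x ≠ 0 → 0 < ⟪A x, x⟫_ℝ) : ∃ α > 0, ∀ x ∈ K, α * ‖x‖ ^ 2 ≤ ⟪A x, x⟫_ℝ := by
  have hcpt : IsCompact (Metric.sphere (0 : E) 1 ∩ (K : Set E)) :=
    (isCompact_sphere 0 1).inter_right K.closed_of_finiteDimensional
  have hcont : Continuous fun x : E => ⟪A x, x⟫_ℝ := by fun_prop
  have key : ∃ α > 0, ∀ x ∈ Metric.sphere (0 : E) 1 ∩ (K : Set E), α ≤ ⟪A x, x⟫_ℝ := by
    rcases (Metric.sphere (0 : E) 1 ∩ (K : Set E)).eq_empty_or_nonempty with he | hne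
    · exact ⟨1, one_pos, by simp [he]⟩
    · obtain ⟨x, hx, hmin⟩ := hcpt.exists_isMinOn hne hcont.continuousOn
      refine ⟨_, hA x hx.2 ?_, fun y hy => hmin hy⟩
      rintro rfl
      simpa using hx.1
  obtain ⟨α, hα, h⟩ := key
  refine ⟨α, hα, fun x hx => ?_⟩
  rcases eq_or_ne x 0 with rfl | hx0
  · simp
  have hn : ‖x‖ ≠ 0 := norm_ne_zero_iff.2 hx0
  have h1 := h (‖x‖⁻¹ • x) ⟨by simp [norm_smul, hn], K.smul_mem _ hx⟩
  simp only [map_smul, inner_smul_left, inner_smul_right, RCLike.conj_to_real] at h1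
  calc α * ‖x‖ ^ 2 ≤ (‖x‖⁻¹ * (‖x‖⁻¹ * ⟪A x, x⟫_ℝ)) * ‖x‖ ^ 2 := by gcongr
    _ = ⟪A x, x⟫_ℝ := by field_simp

variable {Φ Θ : Type*} [NormedAddCommGroup Φ] [InnerProductSpace ℝ Φ] [FiniteDimensional ℝ Φ]
  [NormedAddCommGroup Θ] [InnerProductSpace ℝ Θ] [FiniteDimensional ℝ Θ]

/-- For the plain squared norm the coupling terms cancel by skew-symmetry and only ξ is damped. The
form |ξ|² + |ζ|² + 2τ⟨ξ, Pζ⟩ adds -τc|Pζ|², coercive in ζ on (ker P)ᗮ, at the price of terms that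
the damping of ξ absorbs for small τ. -/
theorem exists_lyapunov_saddle (A : Φ →L[ℝ] Φ) (P : Θ →L[ℝ] Φ) {μ c : ℝ} (hμ : 0 < μ) (hc : 0 < c)
    (hA0 : ∀ v, 0 ≤ ⟪A v, v⟫_ℝ) (hA : ∀ v, ⟪A v, v⟫_ℝ = 0 → A v = 0) :
    ∃ (B : (Φ × Θ) →L[ℝ] (Φ × Θ) →L[ℝ] ℝ) (m κ : ℝ), 0 < m ∧ 0 < κ ∧ (∀ x y, B x y = B y x) ∧
      ∀ x : Φ × Θ, x.1 ∈ (A : Φ →ₗ[ℝ] Φ).kerᗮ → x.2 ∈ (P : Θ →ₗ[ℝ] Φ).kerᗮ →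
        m * ‖x‖ ^ 2 ≤ B x x ∧
        B x (-(μ • A x.1 + c • P x.2), c • P.adjoint x.1) ≤ -κ * ‖x‖ ^ 2 := by
  obtain ⟨α, hα, hAα⟩ := exists_coercive_of_pos A (A : Φ →ₗ[ℝ] Φ).kerᗮ (fun x hx hx0 => by
    refine lt_of_le_of_ne (hA0 x) fun h => hx0 ?_
    have h1 : x ∈ (A : Φ →ₗ[ℝ] Φ).ker := hA x h.symm
    exact inner_self_eq_zero.1 (hx x h1))
  obtain ⟨β, hβ, hPβ⟩ := exists_coercive_of_pos (P.adjoint ∘L P) (P : Θ →ₗ[ℝ] Φ).kerᗮ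
    (fun x hx hx0 => by
      simp only [ContinuousLinearMap.comp_apply, ContinuousLinearMap.adjoint_inner_left]
      refine lt_of_le_of_ne real_inner_self_nonneg fun h => hx0 ?_
      have h1 : x ∈ (P : Θ →ₗ[ℝ] Φ).ker := inner_self_eq_zero.1 h.symm
      exact inner_self_eq_zero.1 (hx x h1))
  have hPβ' : ∀ x ∈ (P : Θ →ₗ[ℝ] Φ).kerᗮ, β * ‖x‖ ^ 2 ≤ ‖P x‖ ^ 2 := fun x hx => by
    have := hPβ x hx
    rwa [ContinuousLinearMap.comp_apply, ContinuousLinearMap.adjoint_inner_left,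
      real_inner_self_eq_norm_sq] at this
  set l : ℝ := ‖A‖ + ‖P‖
  have hl : 0 ≤ l := by positivity
  have hAl : ∀ x, ‖A x‖ ≤ l * ‖x‖ := fun x => (A.le_opNorm x).trans (by
    gcongr; simp only [l]; linarith [norm_nonneg P])
  have hPl : ∀ x, ‖P x‖ ≤ l * ‖x‖ := fun x => (P.le_opNorm x).trans (by
    gcongr; simp only [l]; linarith [norm_nonneg A])
  have hPsl : ∀ x, ‖P.adjoint x‖ ≤ l * ‖x‖ := fun x => (P.adjoint.le_opNorm x).trans (by
    gcongr; rw [LinearIsometryEquiv.norm_map]; simp only [l]; linarith [norm_nonneg A])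
  set D : ℝ := c * l ^ 2 + μ ^ 2 * l ^ 2 / (2 * c) + 1
  have hD : 0 < D := by positivity
  -- The first bound keeps the form positive with constant 1/2. The second lets half of the damping
  -- `μ * α` absorb everything the cross term creates in ξ, which `D` collects.
  set τ : ℝ := min (1 / (2 * (l + 1))) (μ * α / (2 * D))
  have hτ : 0 < τ := by positivity
  have hτl : τ * l ≤ 1 / 2 := by
    have h1 : τ * (2 * (l + 1)) ≤ 1 := by
      rw [← le_div_iff₀ (by positivity)]; exact min_le_left _ _
    nlinarith
  have hτD : τ * D ≤ μ * α / 2 := by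
    have h1 : τ * (2 * D) ≤ μ * α := by
      rw [← le_div_iff₀ (by positivity)]; exact min_le_right _ _
    linarith
  set F := ContinuousLinearMap.fst ℝ Φ Θ
  set G := ContinuousLinearMap.snd ℝ Φ Θ
  set B : (Φ × Θ) →L[ℝ] (Φ × Θ) →L[ℝ] ℝ := (innerSL ℝ).bilinearComp F F +
    (innerSL ℝ).bilinearComp G G + τ • ((innerSL ℝ).bilinearComp F (P ∘L G) +
      (innerSL ℝ).bilinearComp (P ∘L G) F)
  have hBe : ∀ x y, B x y = ⟪x.1, y.1⟫_ℝ + ⟪x.2, y.2⟫_ℝ +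
      τ * (⟪x.1, P y.2⟫_ℝ + ⟪P x.2, y.1⟫_ℝ) := fun x y => rfl
  have hsup : ∀ x : Φ × Θ, ‖x‖ ^ 2 ≤ ‖x.1‖ ^ 2 + ‖x.2‖ ^ 2 := fun x => by
    rw [Prod.norm_def]
    rcases max_cases ‖x.1‖ ‖x.2‖ with h | h <;> rw [h.1] <;> nlinarith [sq_nonneg ‖x.1‖, sq_nonneg ‖x.2‖]
  refine ⟨B, 1 / 2, min (μ * α / 2) (τ * c * β / 2), by norm_num, by positivity, ?_, ?_⟩
  · intro x y
    rw [hBe, hBe, real_inner_comm x.1 y.1, real_inner_comm x.2 y.2, real_inner_comm x.1 (P y.2),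
      real_inner_comm (P x.2) y.1]
    ring
  · rintro ⟨ξ, ζ⟩ hξ hζ
    have hsup' : ‖((ξ, ζ) : Φ × Θ)‖ ^ 2 ≤ ‖ξ‖ ^ 2 + ‖ζ‖ ^ 2 := hsup (ξ, ζ)
    have hp : 0 ≤ ‖ξ‖ := norm_nonneg _
    have hq : 0 ≤ ‖ζ‖ := norm_nonneg _
    constructor
    · rw [hBe]
      simp only [real_inner_self_eq_norm_sq, real_inner_comm ξ (P ζ)]
      have h1 : |⟪ξ, P ζ⟫_ℝ| ≤ ‖ξ‖ * (l * ‖ζ‖) :=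
        (abs_real_inner_le_norm _ _).trans (by gcongr; exact hPl ζ)
      have h2 := neg_le_of_abs_le h1
      have h3 : τ * l * (‖ξ‖ * ‖ζ‖) ≤ 1 / 2 * (‖ξ‖ * ‖ζ‖) := by gcongr
      have h4 := mul_le_mul_of_nonneg_left h2 hτ.le
      nlinarith [sq_nonneg (‖ξ‖ - ‖ζ‖)]
    · rw [hBe]
      simp only [inner_neg_right, inner_add_right, inner_smul_right, map_smul]
      have e1 : ⟪ξ, P (P.adjoint ξ)⟫_ℝ = ‖P.adjoint ξ‖ ^ 2 := by
        rw [← ContinuousLinearMap.adjoint_inner_left, real_inner_self_eq_norm_sq]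
      have e2 : ⟪ζ, P.adjoint ξ⟫_ℝ = ⟪ξ, P ζ⟫_ℝ := by
        rw [ContinuousLinearMap.adjoint_inner_right, real_inner_comm]
      rw [e1, e2, real_inner_self_eq_norm_sq, real_inner_comm (A ξ) ξ]
      have h1 := hAα ξ hξ
      have h2 := hPβ' ζ hζ
      have h3 : ‖P.adjoint ξ‖ ^ 2 ≤ (l * ‖ξ‖) ^ 2 := by gcongr; exact hPsl ξ
      have h4 : |⟪P ζ, A ξ⟫_ℝ| ≤ ‖P ζ‖ * (l * ‖ξ‖) :=
        (abs_real_inner_le_norm _ _).trans (by gcongr; exact hAl ξ)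
      have h5 := neg_le_of_abs_le h4
      set n := ‖P ζ‖
      -- Young's inequality, spending half of the gain `c * n ^ 2`; the other half provides the
      -- coercivity in ζ.
      have h6 : μ * (n * (l * ‖ξ‖)) ≤ c / 2 * n ^ 2 + μ ^ 2 * l ^ 2 / (2 * c) * ‖ξ‖ ^ 2 := by
        have : 0 ≤ (c * n - μ * l * ‖ξ‖) ^ 2 / (2 * c) := by positivity
        have h7 : (c * n - μ * l * ‖ξ‖) ^ 2 / (2 * c) =
          c / 2 * n ^ 2 + μ ^ 2 * l ^ 2 / (2 * c) * ‖ξ‖ ^ 2 - μ * (n * (l * ‖ξ‖)) := by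
          field_simp; ring
        linarith
      have hκ1 : min (μ * α / 2) (τ * c * β / 2) ≤ μ * α / 2 := min_le_left _ _
      have hκ2 : min (μ * α / 2) (τ * c * β / 2) ≤ τ * c * β / 2 := min_le_right _ _
      set κ := min (μ * α / 2) (τ * c * β / 2)
      have hκ0 : 0 ≤ κ := by positivity
      have f1 : κ * ‖((ξ, ζ) : Φ × Θ)‖ ^ 2 ≤ μ * α / 2 * ‖ξ‖ ^ 2 + τ * c * β / 2 * ‖ζ‖ ^ 2 :=
        (mul_le_mul_of_nonneg_left hsup' hκ0).trans (by rw [mul_add]; gcongr)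
      have f2 := mul_le_mul_of_nonneg_left h1 hμ.le
      have f3 := mul_le_mul_of_nonneg_left h2 (show 0 ≤ τ * c / 2 by positivity)
      have f4 := mul_le_mul_of_nonneg_left h3 (show 0 ≤ τ * c by positivity)
      have f5 := mul_le_mul_of_nonneg_left h5 (show 0 ≤ τ * μ by positivity)
      have f6 := mul_le_mul_of_nonneg_left h6 hτ.le
      have f7 : τ * D * ‖ξ‖ ^ 2 ≤ μ * α / 2 * ‖ξ‖ ^ 2 := by gcongr
      have f8 : 0 ≤ τ * ‖ξ‖ ^ 2 := by positivity
      have f9 : τ * D * ‖ξ‖ ^ 2 = τ * c * (l * ‖ξ‖) ^ 2 +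
        τ * (μ ^ 2 * l ^ 2 / (2 * c) * ‖ξ‖ ^ 2) + τ * ‖ξ‖ ^ 2 := by simp only [D]; ring
      linarith

end Coercive

/-! ### Normal-coordinate linearization, delayed contraction, and the error of one alternating step.
-/

section Dynamics

open Asymptotics
open scoped InnerProductSpace

/-- If `f` vanishes on a set with retraction `ρ` and normal coordinate `ξ`, then `f` is to first
order a function of the normal coordinate, relative to the distance to the set. -/
theorem HasStrictFDerivAt.isLittleO_sub_normal_coordinate {E H : Type*} [NormedAddCommGroup E]
    [NormedSpace ℝ E] [NormedAddCommGroup H] [NormedSpace ℝ H] {f : E → H} {L : E →L[ℝ] H} {x₀ : E}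
    (hf : HasStrictFDerivAt f L x₀) {ξ ρ : E → E} (hρ : Tendsto ρ (𝓝 x₀) (𝓝 x₀))
    (h0 : ∀ᶠ x in 𝓝 x₀, f (ρ x) = 0) (hξ : (fun x => x - ρ x - ξ x) =o[𝓝 x₀] ξ) :
    (fun x => f x - L (ξ x)) =o[𝓝 x₀] ξ := by
  have h1 : (fun x => x - ρ x) =O[𝓝 x₀] ξ := by
    simpa using hξ.isBigO.add (isBigO_refl ξ (𝓝 x₀))
  have h2 : (fun x => f x - f (ρ x) - L (x - ρ x)) =o[𝓝 x₀] ξ :=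
    (hf.isLittleO.comp_tendsto (tendsto_id.prodMk_nhds hρ)).trans_isBigO h1
  have h3 : (fun x => L (x - ρ x - ξ x)) =o[𝓝 x₀] ξ := (L.isBigO_comp _ _).trans_isLittleO hξ
  refine (h2.add h3).congr' ?_ EventuallyEq.rfl
  filter_upwards [h0] with x hx
  rw [hx]
  simp only [map_sub]
  abel

theorem isLittleO_normal_coordinate_prod {Φ Θ : Type*} [NormedAddCommGroup Φ]
    [NormedAddCommGroup Θ] {φ₀ : Φ} {θ₀ : Θ} {ξ ρ : Φ → Φ} {ζ σ : Θ → Θ}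
    (hξ : (fun x => x - ρ x - ξ x) =o[𝓝 φ₀] ξ) (hζ : (fun x => x - σ x - ζ x) =o[𝓝 θ₀] ζ) :
    (fun y : Φ × Θ => y - (ρ y.1, σ y.2) - (ξ y.1, ζ y.2)) =o[𝓝 (φ₀, θ₀)]
      fun y => (ξ y.1, ζ y.2) := by
  have h1 := hξ.comp_tendsto (continuous_fst.tendsto (φ₀, θ₀))
  have h2 := hζ.comp_tendsto (continuous_snd.tendsto (φ₀, θ₀))
  have b1 : (fun y : Φ × Θ => ξ y.1) =O[𝓝 (φ₀, θ₀)] fun y => (ξ y.1, ζ y.2) :=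
    isBigO_of_le _ fun y => le_max_left _ _
  have b2 : (fun y : Φ × Θ => ζ y.2) =O[𝓝 (φ₀, θ₀)] fun y => (ξ y.1, ζ y.2) :=
    isBigO_of_le _ fun y => le_max_right _ _
  exact (h1.trans_isBigO b1).prod_left (h2.trans_isBigO b2)

/-- A sequence whose steps are controlled by a quantity that contracts relative to its maximum over
a window of bounded length converges without leaving a given ball. -/
theorem tendsto_of_delayed_contraction {H : Type*} [NormedAddCommGroup H] [CompleteSpace H]
    {z : ℕ → H} {zs : H} {u : ℕ → ℝ} {ρ C r h₀ σ : ℝ} {N : ℕ} (hσ0 : 0 < σ) (hσ1 : σ < 1)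
    (hρσ : ρ ≤ σ ^ (N + 1)) (hC : 0 ≤ C) (hu : ∀ t, 0 ≤ u t)
    (hstep : ∀ t, (∀ s ≤ t, dist (z s) zs < r) → ∀ h ≤ h₀, (∀ j ≤ N, u (t - j) ≤ h) →
      u (t + 1) ≤ ρ * h ∧ dist (z t) (z (t + 1)) ≤ C * h)
    (hu0 : u 0 ≤ h₀) (hr : dist (z 0) zs + C * (σ ^ N)⁻¹ * u 0 / (1 - σ) < r) :
    (∀ t, dist (z t) zs < r) ∧ Tendsto u atTop (𝓝 0) ∧ ∃ z', Tendsto z atTop (𝓝 z') := by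
  set K : ℝ := C * (σ ^ N)⁻¹ * u 0
  have hK : 0 ≤ K := by have := hu 0; positivity
  have hgeom : ∀ t : ℕ, K * ∑ i ∈ Finset.range t, σ ^ i ≤ K / (1 - σ) := fun t => by
    rw [div_eq_mul_inv]
    refine mul_le_mul_of_nonneg_left ?_ hK
    rw [← tsum_geometric_of_lt_one hσ0.le hσ1]
    exact (summable_geometric_of_lt_one hσ0.le hσ1).sum_le_tsum _ fun i _ => by positivity
  have key : ∀ t, (∀ s ≤ t, u s ≤ σ ^ s * u 0) →
      (∀ s ≤ t, dist (z s) zs ≤ dist (z 0) zs + K * ∑ i ∈ Finset.range s, σ ^ i) →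
      u (t + 1) ≤ σ ^ (t + 1) * u 0 ∧ dist (z t) (z (t + 1)) ≤ K * σ ^ t := by
    intro t h1 h2
    have h3 : ∀ j ≤ N, u (t - j) ≤ σ ^ (t - N) * u 0 := fun j hj =>
      (h1 _ (Nat.sub_le _ _)).trans (mul_le_mul_of_nonneg_right
        (pow_le_pow_of_le_one hσ0.le hσ1.le (by omega)) (hu 0))
    have h4 : σ ^ (t - N) * u 0 ≤ h₀ :=
      (mul_le_of_le_one_left (hu 0) (pow_le_one₀ hσ0.le hσ1.le)).trans hu0
    obtain ⟨h5, h6⟩ := hstep t (fun s hs => by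
      have := h2 s hs
      have := hgeom s
      linarith) _ h4 h3
    constructor
    · refine h5.trans ?_
      have h7 : 0 ≤ σ ^ (t - N) * u 0 := mul_nonneg (by positivity) (hu 0)
      -- The window maximum can be `N` steps old, so one contraction must pay for `N + 1` factors
      -- `σ`. With truncated subtraction the exponent is still at least `t + 1` when `t < N`.
      calc ρ * (σ ^ (t - N) * u 0) ≤ σ ^ (N + 1) * (σ ^ (t - N) * u 0) := by gcongr
        _ = σ ^ (N + 1 + (t - N)) * u 0 := by ring
        _ ≤ σ ^ (t + 1) * u 0 := mul_le_mul_of_nonneg_right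
          (pow_le_pow_of_le_one hσ0.le hσ1.le (by omega)) (hu 0)
    · refine h6.trans ?_
      have h8 : σ ^ (t - N) ≤ (σ ^ N)⁻¹ * σ ^ t := by
        rw [inv_mul_eq_div, le_div_iff₀ (by positivity), ← pow_add]
        exact pow_le_pow_of_le_one hσ0.le hσ1.le (by omega)
      have h9 := hu 0
      calc C * (σ ^ (t - N) * u 0) ≤ C * (((σ ^ N)⁻¹ * σ ^ t) * u 0) := by gcongr
        _ = K * σ ^ t := by simp only [K]; ring
  have main : ∀ t, (∀ s ≤ t, u s ≤ σ ^ s * u 0) ∧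
      (∀ s ≤ t, dist (z s) zs ≤ dist (z 0) zs + K * ∑ i ∈ Finset.range s, σ ^ i) := by
    intro t
    induction t with
    | zero =>
      constructor <;> intro s hs <;> obtain rfl := Nat.le_zero.1 hs <;> simp
    | succ t ih =>
      obtain ⟨h1, h2⟩ := key t ih.1 ih.2
      constructor
      · intro s hs
        rcases Nat.le_succ_iff.1 hs with h | rfl
        · exact ih.1 s h
        · exact h1
      · intro s hs
        rcases Nat.le_succ_iff.1 hs with h | rfl
        · exact ih.2 s h
        · have h3 := dist_triangle (z (t + 1)) (z t) zs
          rw [dist_comm (z (t + 1)) (z t)] at h3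
          have h4 := ih.2 t le_rfl
          rw [Nat.succ_eq_add_one, Finset.sum_range_succ, mul_add]
          linarith
  refine ⟨fun t => ?_, ?_, ?_⟩
  · have h1 := (main t).2 t le_rfl
    have h2 := hgeom t
    linarith
  · refine squeeze_zero hu (fun t => (main t).1 t le_rfl) ?_
    simpa using (tendsto_pow_atTop_nhds_zero_of_lt_one hσ0.le hσ1).mul_const (u 0)
  · exact cauchySeq_tendsto_of_complete (cauchySeq_of_le_geometric σ K hσ1
      fun t => (key t (main t).1 (main t).2).2)

variable {Φ Θ : Type*} [NormedAddCommGroup Φ] [InnerProductSpace ℝ Φ]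
  [NormedAddCommGroup Θ] [InnerProductSpace ℝ Θ]

/-- The linearized alternating step in normal coordinates, up to a relatively small error. -/
theorem exists_alternating_step_error (a : (Φ × Θ) →L[ℝ] Φ) (Q : Φ →L[ℝ] Θ) (p : Φ →L[ℝ] Φ)
    (q : Θ →L[ℝ] Θ) (hp : ∀ v, ‖p v‖ ≤ ‖v‖) (hq : ∀ v, ‖q v‖ ≤ ‖v‖) (hpa : ∀ x, p (a x) = a x)
    (hqQ : ∀ v, q (Q v) = Q v) {ε₀ : ℝ} (hε₀ : 0 < ε₀) :
    ∃ ε > 0, ∃ C ≥ 0, (∀ x X h, ‖x‖ ≤ h → ‖X - a x‖ ≤ ε * h → ‖X‖ ≤ C * h) ∧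
      ∀ η : ℝ, 0 < η → η ≤ 1 → ∀ (x x' : Φ × Θ) (X : Φ) (Y : Θ) (h : ℝ), ‖x‖ ≤ h →
        ‖X - a x‖ ≤ ε * h → ‖x'.1 - x.1 - p (η • X)‖ ≤ ε * ‖η • X‖ →
        (∀ k, ‖x'.1‖ ≤ k → ‖x.2‖ ≤ k → ‖Y - Q x'.1‖ ≤ ε * k) →
        ‖Y‖ ≤ C * h ∧ (‖x'.2 - x.2 - q (η • Y)‖ ≤ ε * ‖η • Y‖ →
        ‖x' - (x + η • (a x, Q x.1) + η ^ 2 • ((0 : Φ), Q (a x)))‖ ≤ ε₀ * h) := by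
  set C₁ : ℝ := ‖a‖ + 1
  have hC₁ : 0 < C₁ := by positivity
  set C₂ : ℝ := ‖Q‖ + 1
  have hC₂ : 0 < C₂ := by positivity
  set k₀ : ℝ := 1 + 2 * C₁
  have hk₀ : 0 < k₀ := by positivity
  set D : ℝ := (1 + C₁) * (1 + C₂) + k₀ + C₂ * k₀
  have hD : 0 < D := by positivity
  set ε : ℝ := min 1 (ε₀ / D)
  have hε : 0 < ε := by positivity
  have hε1 : ε ≤ 1 := min_le_left _ _
  have hεD : ε * D ≤ ε₀ := by
    rw [← le_div_iff₀ hD]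
    exact min_le_right _ _
  have hX : ∀ x X h, ‖x‖ ≤ h → ‖X - a x‖ ≤ ε * h → ‖X‖ ≤ C₁ * h := by
    intro x X h hx hXa
    have hh : 0 ≤ h := (norm_nonneg x).trans hx
    calc ‖X‖ = ‖a x + (X - a x)‖ := by congr 1; abel
      _ ≤ ‖a x‖ + ‖X - a x‖ := norm_add_le _ _
      _ ≤ ‖a‖ * ‖x‖ + ε * h := add_le_add (a.le_opNorm x) hXa
      _ ≤ ‖a‖ * h + 1 * h := by gcongr
      _ = C₁ * h := by simp only [C₁]; ring
  refine ⟨ε, hε, C₁ + C₂ * k₀, by positivity, fun x X h hx hXa => (hX x X h hx hXa).trans ?_, ?_⟩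
  · have hh : 0 ≤ h := (norm_nonneg x).trans hx
    have : 0 ≤ C₂ * k₀ * h := by positivity
    linarith
  intro η hη hη1 x x' X Y h hx hXa hx'1 hY
  have hh : 0 ≤ h := (norm_nonneg x).trans hx
  have hXn := hX x X h hx hXa
  have hηX : ‖η • X‖ ≤ C₁ * h := by
    rw [norm_smul, Real.norm_of_nonneg hη.le]
    exact (mul_le_of_le_one_left (norm_nonneg _) hη1).trans hXn
  have hx1 : ‖x.1‖ ≤ h := (norm_fst_le x).trans hx
  have hx2 : ‖x.2‖ ≤ h := (norm_snd_le x).trans hx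
  set e₁ : Φ := x'.1 - (x.1 + η • a x)
  have he₁ : ‖e₁‖ ≤ ε * ((1 + C₁) * h) := by
    have h1 : e₁ = (x'.1 - x.1 - p (η • X)) + η • p (X - a x) := by
      simp only [e₁, map_sub, map_smul, hpa, smul_sub]; abel
    have h2 : ‖η • p (X - a x)‖ ≤ ε * h := by
      rw [norm_smul, Real.norm_of_nonneg hη.le]
      exact (mul_le_of_le_one_left (norm_nonneg _) hη1).trans ((hp _).trans hXa)
    calc ‖e₁‖ ≤ ‖x'.1 - x.1 - p (η • X)‖ + ‖η • p (X - a x)‖ := by rw [h1]; exact norm_add_le _ _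
      _ ≤ ε * (C₁ * h) + ε * h := add_le_add (hx'1.trans (by gcongr)) h2
      _ = ε * ((1 + C₁) * h) := by ring
  have hx'n : ‖x'.1‖ ≤ k₀ * h := by
    have h1 : x'.1 = x.1 + p (η • X) + (x'.1 - x.1 - p (η • X)) := by abel
    calc ‖x'.1‖ ≤ ‖x.1‖ + ‖p (η • X)‖ + ‖x'.1 - x.1 - p (η • X)‖ := by
          conv_lhs => rw [h1]
          exact norm_add₃_le
      _ ≤ h + C₁ * h + 1 * (C₁ * h) := by
          have := (hp (η • X)).trans hηX
          have h4 : ‖x'.1 - x.1 - p (η • X)‖ ≤ 1 * (C₁ * h) := hx'1.trans (by gcongr)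
          linarith
      _ = k₀ * h := by simp only [k₀]; ring
  have hYe : ‖Y - Q x'.1‖ ≤ ε * (k₀ * h) := hY _ hx'n (hx2.trans (by
    simp only [k₀]; nlinarith))
  have hYn : ‖Y‖ ≤ C₂ * (k₀ * h) := by
    calc ‖Y‖ = ‖Q x'.1 + (Y - Q x'.1)‖ := by congr 1; abel
      _ ≤ ‖Q x'.1‖ + ‖Y - Q x'.1‖ := norm_add_le _ _
      _ ≤ ‖Q‖ * (k₀ * h) + 1 * (k₀ * h) := by
        refine add_le_add ((Q.le_opNorm _).trans (by gcongr)) (hYe.trans (by gcongr))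
      _ = C₂ * (k₀ * h) := by simp only [C₂]; ring
  have hηY : ‖η • Y‖ ≤ C₂ * (k₀ * h) := by
    rw [norm_smul, Real.norm_of_nonneg hη.le]
    exact (mul_le_of_le_one_left (norm_nonneg _) hη1).trans hYn
  -- The bound on `Y` must not depend on the expansion of ζ: it is what shows that the new θ is
  -- still where that expansion holds.
  refine ⟨hYn.trans ?_, fun hx'2 => ?_⟩
  · have : 0 ≤ C₁ * h := by positivity
    linarith
  have hsmall : ε * (D * h) ≤ ε₀ * h := by
    rw [← mul_assoc]; gcongr
  refine (norm_prod_le_iff.2 ⟨?_, ?_⟩ : _ ≤ ε * (D * h)).trans hsmall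
  · have h1 : (x' - (x + η • (a x, Q x.1) + η ^ 2 • ((0 : Φ), Q (a x)))).1 = e₁ := by
      simp [e₁]
    rw [h1]
    refine he₁.trans ?_
    have h2 : (1 + C₁) ≤ D := by
      have : 0 ≤ (1 + C₁) * C₂ + k₀ + C₂ * k₀ := by positivity
      simp only [D]; linarith
    gcongr
  -- The generator already sees the updated discriminator, `x.1 + η • a x` up to `e₁`; applying `η •
  -- Q` to it produces the `η ^ 2` term.
  · have h1 : (x' - (x + η • (a x, Q x.1) + η ^ 2 • ((0 : Φ), Q (a x)))).2 =
        (x'.2 - x.2 - q (η • Y)) + η • q (Y - Q x'.1) + η • Q e₁ := by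
      simp only [e₁, Prod.snd_sub, Prod.snd_add, Prod.smul_snd, map_sub, map_add, map_smul, hqQ]
      module
    have h2 : ‖η • q (Y - Q x'.1)‖ ≤ ε * (k₀ * h) := by
      rw [norm_smul, Real.norm_of_nonneg hη.le]
      exact (mul_le_of_le_one_left (norm_nonneg _) hη1).trans ((hq _).trans hYe)
    have h3 : ‖η • Q e₁‖ ≤ C₂ * (ε * ((1 + C₁) * h)) := by
      rw [norm_smul, Real.norm_of_nonneg hη.le]
      refine (mul_le_of_le_one_left (norm_nonneg _) hη1).trans ((Q.le_opNorm _).trans ?_)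
      have : ‖Q‖ ≤ C₂ := by simp only [C₂]; linarith
      gcongr
    rw [h1]
    calc _ ≤ ‖x'.2 - x.2 - q (η • Y)‖ + ‖η • q (Y - Q x'.1)‖ + ‖η • Q e₁‖ := norm_add₃_le
      _ ≤ ε * (C₂ * (k₀ * h)) + ε * (k₀ * h) + C₂ * (ε * ((1 + C₁) * h)) :=
        add_le_add (add_le_add (hx'2.trans (by gcongr)) h2) h3
      _ ≤ ε * (D * h) := by
        have : 0 ≤ ε * ((1 + C₁) * h) := by positivity
        simp only [D]
        linarith

end Dynamics

/-! ### Local convergence for the nonlinear saddle scheme with delays. -/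

section Saddle

open Asymptotics
open scoped InnerProductSpace

theorem exists_pow_eq_of_pos_of_lt_one {ρ : ℝ} (h0 : 0 < ρ) (h1 : ρ < 1) (N : ℕ) :
    ∃ σ : ℝ, 0 < σ ∧ σ < 1 ∧ ρ = σ ^ (N + 1) :=
  ⟨ρ ^ (((N + 1 : ℕ) : ℝ)⁻¹), by positivity, Real.rpow_lt_one h0.le h1 (by positivity),
    (Real.rpow_inv_natCast_pow h0.le (Nat.succ_ne_zero N)).symm⟩

theorem HasStrictFDerivAt.exists_dist_lt_norm_sub_le {E H : Type*} [NormedAddCommGroup E]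
    [NormedSpace ℝ E] [NormedAddCommGroup H] [NormedSpace ℝ H] {f : E → H} {L : E →L[ℝ] H} {x₀ : E}
    (hf : HasStrictFDerivAt f L x₀) {ε : ℝ} (hε : 0 < ε) :
    ∃ r > 0, ∀ x y, dist x x₀ < r → dist y x₀ < r → ‖f x - f y - L (x - y)‖ ≤ ε * ‖x - y‖ := by
  have h := hf.isLittleO.def hε
  rw [nhds_prod_eq] at h
  obtain ⟨r, hr, hb⟩ := Metric.nhds_basis_ball.prod_self.eventually_iff.1 h
  exact ⟨r, hr, fun x y hx hy => @hb (x, y) ⟨hx, hy⟩⟩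

variable {Φ Θ : Type*} [NormedAddCommGroup Φ] [InnerProductSpace ℝ Φ] [FiniteDimensional ℝ Φ]
  [NormedAddCommGroup Θ] [InnerProductSpace ℝ Θ] [FiniteDimensional ℝ Θ]

set_option maxHeartbeats 1000000 in
/-- Local convergence of alternating gradient schemes whose linear part in normal coordinates is
that of a dissipative saddle problem, with delayed higher order terms. -/
theorem exists_step_size_of_saddle (A : Φ →L[ℝ] Φ) (P : Θ →L[ℝ] Φ) {μ c : ℝ} (hμ : 0 < μ)
    (hc : 0 < c) (hA0 : ∀ v, 0 ≤ ⟪A v, v⟫_ℝ) (hA : ∀ v, ⟪A v, v⟫_ℝ = 0 → A v = 0)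
    (hAs : ∀ v w, ⟪A v, w⟫_ℝ = ⟪v, A w⟫_ℝ) (hPA : ∀ v, A v = 0 → ∀ w, ⟪v, P w⟫_ℝ = 0)
    {φs : Φ} {θs : Θ} {ξ : Φ → Φ} {ζ : Θ → Θ} {Sφ : Set Φ} {Sθ : Set Θ}
    (hξm : ∀ x, ξ x ∈ (A : Φ →ₗ[ℝ] Φ).kerᗮ) (hζm : ∀ x, ζ x ∈ (P : Θ →ₗ[ℝ] Φ).kerᗮ)
    (hξd : HasStrictFDerivAt ξ (A : Φ →ₗ[ℝ] Φ).kerᗮ.starProjection φs)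
    (hζd : HasStrictFDerivAt ζ (P : Θ →ₗ[ℝ] Φ).kerᗮ.starProjection θs)
    (hξ0 : ξ φs = 0) (hζ0 : ζ θs = 0)
    (hξc : ∀ᶠ x in 𝓝 φs, ContinuousAt ξ x) (hζc : ∀ᶠ x in 𝓝 θs, ContinuousAt ζ x)
    (hξS : ∀ᶠ x in 𝓝 φs, ξ x = 0 → x ∈ Sφ) (hζS : ∀ᶠ x in 𝓝 θs, ζ x = 0 → x ∈ Sθ) :
    ∃ η₀ : ℝ, 0 < η₀ ∧ ∀ η : ℝ, 0 < η → η < η₀ → ∀ (N : ℕ) (Run : (ℕ → Φ) → (ℕ → Θ) → Prop),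
      (∀ ε > 0, ∃ r > 0, ∀ φ θ, Run φ θ → ∀ t : ℕ,
        (∀ s ≤ t, dist (φ s) φs < r ∧ dist (θ s) θs < r) →
        (∃ X, φ (t + 1) = φ t + η • X ∧ ∀ h, ‖ξ (φ t)‖ ≤ h → (∀ j ≤ N, ‖ζ (θ (t - j))‖ ≤ h) →
          ‖X - (-(μ • A (ξ (φ t)) + c • P (ζ (θ t))))‖ ≤ ε * h) ∧
        (dist (φ (t + 1)) φs < r → ∃ Y, θ (t + 1) = θ t + η • Y ∧
          ∀ h, ‖ξ (φ (t + 1))‖ ≤ h → ‖ζ (θ t)‖ ≤ h →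
            ‖Y - c • P.adjoint (ξ (φ (t + 1)))‖ ≤ ε * h)) →
      ∀ ε : ℝ, 0 < ε → ∃ δ : ℝ, 0 < δ ∧ ∀ φ θ, Run φ θ → dist (φ 0) φs < δ → dist (θ 0) θs < δ →
        (∀ t, dist (φ t) φs < ε ∧ dist (θ t) θs < ε) ∧
        ∃ φ' ∈ Sφ, ∃ θ' ∈ Sθ, Tendsto φ atTop (𝓝 φ') ∧ Tendsto θ atTop (𝓝 θ') := by
  obtain ⟨B, m, κ, hm, hκ, hB, hBx⟩ := exists_lyapunov_saddle A P hμ hc hA0 hA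
  set F := ContinuousLinearMap.fst ℝ Φ Θ
  set G := ContinuousLinearMap.snd ℝ Φ Θ
  set a : (Φ × Θ) →L[ℝ] Φ := -(μ • A ∘L F + c • P ∘L G)
  have ha : ∀ x : Φ × Θ, a x = -(μ • A x.1 + c • P x.2) := fun x => rfl
  set Q : Φ →L[ℝ] Θ := c • P.adjoint
  have hQ : ∀ v, Q v = c • P.adjoint v := fun v => rfl
  set p := (A : Φ →ₗ[ℝ] Φ).kerᗮ.starProjection
  set q := (P : Θ →ₗ[ℝ] Φ).kerᗮ.starProjection
  -- Symmetry of `A` and `hPA` place the ranges of `A` and `P` in the normal space of φ, so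
  -- projecting a step loses nothing of its linear part.
  have hpa : ∀ x, p (a x) = a x := by
    intro x
    rw [Submodule.starProjection_eq_self_iff, ha, Submodule.mem_orthogonal]
    intro v hv
    have hv : A v = 0 := hv
    simp [inner_add_right, inner_smul_right, ← hAs, hv, hPA v hv]
  have hqQ : ∀ v, q (Q v) = Q v := by
    intro v
    rw [Submodule.starProjection_eq_self_iff, hQ, Submodule.mem_orthogonal]
    intro w hw
    have hw : P w = 0 := hw
    simp [inner_smul_right, ContinuousLinearMap.adjoint_inner_right, hw]
  obtain ⟨η₀, hη₀, hη₀1, hcontr⟩ := exists_contraction_of_lyapunov B hB (a.prod (Q ∘L F))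
    ((0 : (Φ × Θ) →L[ℝ] Φ).prod (Q ∘L a))
    {x | x.1 ∈ (A : Φ →ₗ[ℝ] Φ).kerᗮ ∧ x.2 ∈ (P : Θ →ₗ[ℝ] Φ).kerᗮ} hm hκ
    (fun x hx => (hBx x hx.1 hx.2).1) (fun x hx => (hBx x hx.1 hx.2).2)
  -- The step size is fixed by the linear data before `N` and the runs appear; these influence only
  -- the radii and `δ`.
  refine ⟨η₀, hη₀, fun η hη hηη N Run hRun ε hε => ?_⟩
  have hη1 : η ≤ 1 := (hηη.trans_le hη₀1).le
  obtain ⟨ε₁, hε₁, ρ, hρ0, hρ1, hcontr⟩ := hcontr η hη hηη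
  obtain ⟨ε₂, hε₂, C, hC, hXC, hstep⟩ := exists_alternating_step_error a Q p q
    (fun v => Submodule.norm_starProjection_apply_le _ _)
    (fun v => Submodule.norm_starProjection_apply_le _ _) hpa hqQ hε₁
  obtain ⟨r₁, hr₁, hRun⟩ := hRun ε₂ hε₂
  obtain ⟨r₂, hr₂, hξr⟩ := hξd.exists_dist_lt_norm_sub_le hε₂
  obtain ⟨r₃, hr₃, hζr⟩ := hζd.exists_dist_lt_norm_sub_le hε₂
  obtain ⟨r₄, hr₄, hξn⟩ := Metric.eventually_nhds_iff.1 (hξc.and hξS)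
  obtain ⟨r₅, hr₅, hζn⟩ := Metric.eventually_nhds_iff.1 (hζc.and hζS)
  obtain ⟨r, hr, hrr₁, hrr₂, hrr₃, hrr₄, hrr₅, hrε⟩ : ∃ r > 0, r ≤ r₁ ∧ r ≤ r₂ ∧ r ≤ r₃ ∧ r ≤ r₄ ∧
      r ≤ r₅ ∧ r ≤ ε :=
    ⟨min r₁ (min r₂ (min r₃ (min r₄ (min r₅ ε)))), by positivity, by simp, by simp, by simp,
      by simp, by simp, by simp⟩
  set x : Φ × Θ → Φ × Θ := fun z => (ξ z.1, ζ z.2)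
  -- The Lyapunov norm, scaled so that it dominates the norm of the normal coordinates; it vanishes
  -- and is continuous at the equilibrium.
  set u : Φ × Θ → ℝ := fun z => √(B (x z) (x z) / m)
  have hxB : ∀ z, m * ‖x z‖ ^ 2 ≤ B (x z) (x z) := fun z => (hBx _ (hξm _) (hζm _)).1
  have hxu : ∀ z, ‖x z‖ ≤ u z := fun z => by
    refine Real.le_sqrt_of_sq_le ?_
    rw [le_div_iff₀ hm, mul_comm]
    exact hxB z
  have huB : ∀ z, B (x z) (x z) = m * u z ^ 2 := fun z => by
    simp only [u]
    rw [Real.sq_sqrt (div_nonneg ((mul_nonneg hm.le (sq_nonneg _)).trans (hxB z)) hm.le)]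
    field_simp
  have hu0 : ∀ z, 0 ≤ u z := fun z => Real.sqrt_nonneg _
  have hρs0 : 0 < √ρ := Real.sqrt_pos.2 hρ0
  have hρs1 : √ρ < 1 := by rw [Real.sqrt_lt' one_pos]; simpa using hρ1
  -- The factor `ρ` contracts the squares, so `u` itself contracts by `√ρ`, whose root of order `N +
  -- 1` is the rate per step.
  obtain ⟨σ, hσ0, hσ1, hσ⟩ := exists_pow_eq_of_pos_of_lt_one hρs0 hρs1 N
  set zs : Φ × Θ := (φs, θs)
  -- Below this size one step moves each component by less than `r / 2`, so from the ball of radius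
  -- `r / 2` the next iterate stays where the estimates of radius `r` hold.
  set h₀ : ℝ := r / 2 / (C + 1)
  have hh₀ : 0 < h₀ := by positivity
  have hxc : ContinuousAt x zs :=
    (ContinuousAt.comp (f := Prod.fst) hξd.continuousAt continuousAt_fst).prodMk
      (ContinuousAt.comp (f := Prod.snd) hζd.continuousAt continuousAt_snd)
  have huc : ContinuousAt u zs := by
    refine ContinuousAt.sqrt (ContinuousAt.div_const ?_ _)
    exact (B.continuous.continuousAt.comp hxc).clm_apply hxc
  have hus : u zs = 0 := by
    have h1 : x zs = 0 := by simp [x, zs, hξ0, hζ0]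
    simp [u, h1]
  have hsmall : ∀ᶠ z in 𝓝 zs, u z < h₀ ∧ dist z zs + C * (σ ^ N)⁻¹ * u z / (1 - σ) < r / 2 := by
    refine (huc.tendsto.eventually_lt_const (by rwa [hus])).and ?_
    have h1 : ContinuousAt (fun z => dist z zs + C * (σ ^ N)⁻¹ * u z / (1 - σ)) zs :=
      (continuousAt_id.dist continuousAt_const).add ((continuousAt_const.mul huc).div_const _)
    refine h1.tendsto.eventually_lt_const ?_
    simpa [hus] using hr
  obtain ⟨δ, hδ, hδs⟩ := Metric.eventually_nhds_iff.1 hsmall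
  refine ⟨δ, hδ, fun φ θ hR hφ hθ => ?_⟩
  set z : ℕ → Φ × Θ := fun t => (φ t, θ t)
  obtain ⟨hz1, hz2⟩ := hδs (show dist (z 0) zs < δ from max_lt hφ hθ)
  have hzd : ∀ t R, dist (z t) zs < R ↔ dist (φ t) φs < R ∧ dist (θ t) θs < R := fun t R => max_lt_iff
  obtain ⟨hb, hut, ⟨φ', θ'⟩, hlim⟩ := tendsto_of_delayed_contraction (z := z) (zs := zs)
    (u := fun t => u (z t)) hσ0 hσ1 hσ.le hC (fun t => hu0 _) (h₀ := h₀) (r := r / 2) (by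
      intro t hts h hh huh
      have hut : u (z t) ≤ h := huh 0 (Nat.zero_le _)
      have hh0 : 0 ≤ h := (hu0 _).trans hut
      have hCr : C * h < r / 2 := by
        have h1 : (C + 1) * h ≤ r / 2 := by
          rw [mul_comm, ← le_div_iff₀ (by positivity)]; exact hh
        rcases hh0.eq_or_lt with h2 | h2
        · rw [← h2]; simpa using hr
        · linarith
      have hts' : ∀ s ≤ t, dist (φ s) φs < r / 2 ∧ dist (θ s) θs < r / 2 :=
        fun s hs => (hzd s _).1 (hts s hs)
      obtain ⟨⟨X, hX, hXe⟩, hYY⟩ := hRun φ θ hR t fun s hs =>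
        ⟨by linarith [(hts' s hs).1], by linarith [(hts' s hs).2]⟩
      have hxt : ‖x (z t)‖ ≤ h := (hxu _).trans hut
      have hXa : ‖X - a (x (z t))‖ ≤ ε₂ * h := by
        rw [ha]
        exact hXe h ((norm_fst_le (x (z t))).trans hxt) fun j hj =>
          (norm_snd_le (x (z (t - j)))).trans ((hxu _).trans (huh j hj))
      have hXn := hXC _ X h hxt hXa
      have hηn : ∀ v : ℝ, 0 ≤ v → v ≤ C * h → ‖η‖ * v ≤ C * h := fun v hv0 hv => by
        rw [Real.norm_of_nonneg hη.le]
        exact (mul_le_of_le_one_left hv0 hη1).trans hv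
      have hdφ : dist (φ t) (φ (t + 1)) ≤ C * h := by
        rw [hX, dist_self_add_right, norm_smul]; exact hηn _ (norm_nonneg _) hXn
      have hφt := (hts' t le_rfl).1
      have hθt := (hts' t le_rfl).2
      have hφ1 : dist (φ (t + 1)) φs < r := by
        have := dist_triangle (φ (t + 1)) (φ t) φs
        rw [dist_comm (φ (t + 1)) (φ t)] at this
        linarith
      obtain ⟨Y, hY, hYe⟩ := hYY (by linarith)
      have hx'1 : ‖(x (z (t + 1))).1 - (x (z t)).1 - p (η • X)‖ ≤ ε₂ * ‖η • X‖ := by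
        have h1 := hξr (φ (t + 1)) (φ t) (by linarith) (by linarith)
        have h2 : φ (t + 1) - φ t = η • X := by rw [hX]; abel
        rwa [h2] at h1
      have hθ1 : ‖Y‖ ≤ C * h → dist (θ (t + 1)) θs < r := by
        intro hYn
        have h1 : dist (θ t) (θ (t + 1)) ≤ C * h := by
          rw [hY, dist_self_add_right, norm_smul]; exact hηn _ (norm_nonneg _) hYn
        have := dist_triangle (θ (t + 1)) (θ t) θs
        rw [dist_comm (θ (t + 1)) (θ t)] at this
        linarith
      have hx'2 : ‖Y‖ ≤ C * h →
          ‖(x (z (t + 1))).2 - (x (z t)).2 - q (η • Y)‖ ≤ ε₂ * ‖η • Y‖ := by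
        intro hYn
        have h1 := hζr (θ (t + 1)) (θ t) (by linarith [hθ1 hYn]) (by linarith)
        have h2 : θ (t + 1) - θ t = η • Y := by rw [hY]; abel
        rwa [h2] at h1
      obtain ⟨hYn, hstep⟩ := hstep η hη hη1 (x (z t)) (x (z (t + 1))) X Y h hxt hXa hx'1
        (fun k h1 h2 => hYe k h1 h2)
      have hc' := hcontr (x (z t)) ⟨hξm _, hζm _⟩ (x (z (t + 1))) h hh0
        (by rw [huB]; gcongr) (hstep (hx'2 hYn))
      refine ⟨?_, ?_⟩
      · rw [huB] at hc'
        have h1 : u (z (t + 1)) ^ 2 ≤ (√ρ * h) ^ 2 := by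
          rw [mul_pow, Real.sq_sqrt hρ0.le]
          refine le_of_mul_le_mul_left ?_ hm
          linarith
        exact (sq_le_sq₀ (hu0 _) (by positivity)).1 h1
      · refine max_le hdφ ?_
        show dist (θ t) (θ (t + 1)) ≤ C * h
        rw [hY, dist_self_add_right, norm_smul]
        exact hηn _ (norm_nonneg _) hYn) hz1.le hz2
  have hφlim : Tendsto φ atTop (𝓝 φ') := (continuous_fst.tendsto _).comp hlim
  have hθlim : Tendsto θ atTop (𝓝 θ') := (continuous_snd.tendsto _).comp hlim
  have hlimd : dist ((φ', θ') : Φ × Θ) zs ≤ r / 2 :=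
    le_of_tendsto (hlim.dist tendsto_const_nhds) (Eventually.of_forall fun t => (hb t).le)
  have hφd : dist φ' φs < r := by
    have : dist φ' φs ≤ r / 2 := (le_max_left _ _).trans hlimd
    linarith
  have hθd : dist θ' θs < r := by
    have : dist θ' θs ≤ r / 2 := (le_max_right _ _).trans hlimd
    linarith
  have hxlim : Tendsto (fun t => x (z t)) atTop (𝓝 0) :=
    squeeze_zero_norm (fun t => hxu _) hut
  refine ⟨fun t => ?_, φ', ?_, θ', ?_, hφlim, hθlim⟩
  · have := (hzd t _).1 (hb t)
    exact ⟨by linarith [this.1], by linarith [this.2]⟩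
  · obtain ⟨h1, h2⟩ := hξn (hφd.trans_le hrr₄)
    exact h2 (tendsto_nhds_unique (h1.tendsto.comp hφlim) ((continuous_fst.tendsto _).comp hxlim))
  · obtain ⟨h1, h2⟩ := hζn (hθd.trans_le hrr₅)
    exact h2 (tendsto_nhds_unique (h1.tendsto.comp hθlim) ((continuous_snd.tendsto _).comp hxlim))

end Saddle

/-! ### Second order chain rules, pointwise at zeros and under the integral. -/

section Calculus

set_option maxSynthPendingDepth 3

open scoped InnerProductSpace

/-- The Riesz representation of real functionals, as a linear map. -/
def rieszVector (E : Type*) [NormedAddCommGroup E] [InnerProductSpace ℝ E] [CompleteSpace E] :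
    (E →L[ℝ] ℝ) →L[ℝ] E where
  toFun l := (InnerProductSpace.toDual ℝ E).symm l
  map_add' := map_add _
  map_smul' c l := by simp
  cont := (InnerProductSpace.toDual ℝ E).symm.continuous

theorem toDual_rieszVector {E : Type*} [NormedAddCommGroup E] [InnerProductSpace ℝ E]
    [CompleteSpace E] (l : E →L[ℝ] ℝ) : InnerProductSpace.toDual ℝ E (rieszVector E l) = l :=
  LinearIsometryEquiv.apply_symm_apply _ _

theorem inner_rieszVector {E : Type*} [NormedAddCommGroup E] [InnerProductSpace ℝ E]
    [CompleteSpace E] (l : E →L[ℝ] ℝ) (v : E) : ⟪rieszVector E l, v⟫_ℝ = l v := by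
  rw [← InnerProductSpace.toDual_apply_apply (𝕜 := ℝ), toDual_rieszVector]

theorem HasFDerivAt.hasGradientAt_rieszVector {E : Type*} [NormedAddCommGroup E]
    [InnerProductSpace ℝ E] [CompleteSpace E] {f : E → ℝ} {l : E →L[ℝ] ℝ} {x : E}
    (h : HasFDerivAt f l x) : HasGradientAt f (rieszVector E l) x := by
  rw [hasGradientAt_iff_hasFDerivAt, toDual_rieszVector]
  exact h

variable {E Ω : Type*} [NormedAddCommGroup E] [NormedSpace ℝ E] [MeasurableSpace Ω]
  {μ : Measure Ω}

theorem fderiv_fderiv_comp_of_eq_zero {f : ℝ → ℝ} {k : E → ℝ} {x : E} (hf : ContDiffAt ℝ 2 f 0)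
    (hk : ContDiff ℝ 2 k) (h0 : k x = 0) (u v : E) :
    fderiv ℝ (fderiv ℝ fun y => f (k y)) x u v =
      iteratedDeriv 2 f 0 * (fderiv ℝ k x u * fderiv ℝ k x v) +
        deriv f 0 * fderiv ℝ (fderiv ℝ k) x u v := by
  rw [← h0] at hf ⊢
  have hfn : ∀ᶠ y in 𝓝 (k x), DifferentiableAt ℝ f y :=
    (hf.eventually (by simp)).mono fun y hy => hy.differentiableAt (by norm_num)
  have hk1 : Differentiable ℝ k := hk.differentiable (by norm_num)
  have h1 : (fderiv ℝ fun y => f (k y)) =ᶠ[𝓝 x] fun y => deriv f (k y) • fderiv ℝ k y := by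
    filter_upwards [hk1.continuous.continuousAt.eventually hfn] with y hy
    exact (hy.hasDerivAt.comp_hasFDerivAt y (hk1 y).hasFDerivAt).fderiv
  have hf2 : HasDerivAt (deriv f) (iteratedDeriv 2 f (k x)) (k x) := by
    have h2 : ContDiffAt ℝ 1 (deriv f) (k x) := by
      have : ContDiffAt ℝ 1 (fderiv ℝ f) (k x) := hf.fderiv_right (by norm_num)
      exact this.clm_apply contDiffAt_const
    rw [iteratedDeriv_succ, iteratedDeriv_one]
    exact (h2.differentiableAt one_ne_zero).hasDerivAt
  have hk2 : HasFDerivAt (fderiv ℝ k) (fderiv ℝ (fderiv ℝ k) x) x :=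
    ((hk.fderiv_right (m := 1) (by norm_num)).differentiable one_ne_zero x).hasFDerivAt
  have h3 := (hf2.comp_hasFDerivAt x (hk1 x).hasFDerivAt).fun_smul hk2
  have h4 : HasFDerivAt (fderiv ℝ fun y => f (k y)) _ x := h3.congr_of_eventuallyEq h1
  rw [h4.fderiv]
  simp
  ring

theorem HasFDerivAt.comp_prodMk_left {F G : Type*} [NormedAddCommGroup F] [NormedSpace ℝ F]
    [NormedAddCommGroup G] [NormedSpace ℝ G] {f : E × F → G} {l : E × F →L[ℝ] G} {a : E} {b : F}
    (h : HasFDerivAt f l (a, b)) :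
    HasFDerivAt (fun x => f (x, b)) (l.comp (ContinuousLinearMap.inl ℝ E F)) a :=
  h.comp a (hasFDerivAt_prodMk_left a b)

theorem HasFDerivAt.comp_prodMk_right {F G : Type*} [NormedAddCommGroup F] [NormedSpace ℝ F]
    [NormedAddCommGroup G] [NormedSpace ℝ G] {f : E × F → G} {l : E × F →L[ℝ] G} {a : E} {b : F}
    (h : HasFDerivAt f l (a, b)) :
    HasFDerivAt (fun y => f (a, y)) (l.comp (ContinuousLinearMap.inr ℝ E F)) b :=
  h.comp b (hasFDerivAt_prodMk_right a b)

/-- Vanishing near `b`, not only at `b`, is what removes the second derivative in the second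
variable. -/
theorem fderiv_snd_eq_zero_of_eventually {F : Type*} [NormedAddCommGroup F] [NormedSpace ℝ F]
    {f : E × F → ℝ} {a : E} {b : F} (hf : ContDiff ℝ 2 f) (h0 : ∀ᶠ y in 𝓝 b, f (a, y) = 0) (w : F) :
    fderiv ℝ f (a, b) (0, w) = 0 ∧ ∀ w', fderiv ℝ (fderiv ℝ f) (a, b) (0, w) (0, w') = 0 := by
  have hf1 : Differentiable ℝ f := hf.differentiable (by norm_num)
  have hf2 : Differentiable ℝ (fderiv ℝ f) :=
    (hf.fderiv_right (m := 1) (by norm_num)).differentiable one_ne_zero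
  have hp : ∀ y : F, HasFDerivAt (fun y : F => (a, y)) (ContinuousLinearMap.inr ℝ E F) y :=
    fun y => hasFDerivAt_prodMk_right a y
  have h1 : ∀ᶠ y in 𝓝 b, ∀ w, fderiv ℝ f (a, y) (0, w) = 0 := by
    filter_upwards [h0.eventually_nhds] with y hy w
    have h2 := (hf1 (a, y)).hasFDerivAt.comp y (hp y)
    have h3 : HasFDerivAt (f ∘ fun y => (a, y)) (0 : F →L[ℝ] ℝ) y :=
      (hasFDerivAt_const (0 : ℝ) y).congr_of_eventuallyEq hy
    have := congrArg (fun l : F →L[ℝ] ℝ => l w) (h2.unique h3)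
    simpa using this
  refine ⟨h1.self_of_nhds w, fun w' => ?_⟩
  have h2 := ((hf2 (a, b)).hasFDerivAt.comp b (hp b)).clm_apply
    (hasFDerivAt_const ((0 : E), w') b)
  have h3 : HasFDerivAt (fun y => fderiv ℝ f (a, y) (0, w')) (0 : F →L[ℝ] ℝ) b :=
    (hasFDerivAt_const (0 : ℝ) b).congr_of_eventuallyEq (h1.mono fun y hy => hy w')
  have := congrArg (fun l : F →L[ℝ] ℝ => l w) (h2.unique h3)
  simpa using this

variable [FiniteDimensional ℝ E]

theorem DominatedC2.eventually_hasFDerivAt {F : E → Ω → ℝ} {x₀ : E} (h : DominatedC2 μ F x₀) :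
    ∀ᶠ x in 𝓝 x₀, Integrable (F x) μ ∧
      HasFDerivAt (fun x => ∫ ω, F x ω ∂μ) (∫ ω, fderiv ℝ (fun y => F y ω) x ∂μ) x ∧
      Integrable (fun ω => fderiv ℝ (fun y => F y ω) x) μ := by
  obtain ⟨r, hr, hi, -, hi1, hd, -, -, -⟩ := h.exists_ball
  filter_upwards [Metric.ball_mem_nhds x₀ hr] with x hx
  exact ⟨hi x hx, hd x hx, hi1 x hx⟩

theorem DominatedC2.contDiffAt_integral {F : E → Ω → ℝ} {x₀ : E} (h : DominatedC2 μ F x₀) :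
    ContDiffAt ℝ 2 (fun x => ∫ ω, F x ω ∂μ) x₀ := by
  obtain ⟨r, hr, -, -, -, -, -, -, hc⟩ := h.exists_ball
  exact hc

theorem DominatedC2.hasStrictFDerivAt_fderiv_integral {F : E → Ω → ℝ} {x₀ : E}
    (h : DominatedC2 μ F x₀) : HasStrictFDerivAt (fderiv ℝ fun x => ∫ ω, F x ω ∂μ)
      (fderiv ℝ (fderiv ℝ fun x => ∫ ω, F x ω ∂μ) x₀) x₀ :=
  (h.contDiffAt_integral.fderiv_right (m := 1) (by norm_num)).hasStrictFDerivAt one_ne_zero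

/-- Where the inner function is almost surely 0, the outer function enters only through `deriv f 0`.
All losses thus share one first order functional on the equilibrium set. -/
theorem DominatedC2.fderiv_integral_comp {κ : E → Ω → ℝ} {f : ℝ → ℝ} {x₀ : E}
    (h : DominatedC2 μ (fun x ω => f (κ x ω)) x₀) (hκ : ∀ ω, ContDiff ℝ 2 fun x => κ x ω)
    (hf : DifferentiableAt ℝ f 0) :
    ∀ᶠ x in 𝓝 x₀, (∀ᵐ ω ∂μ, κ x ω = 0) → fderiv ℝ (fun x => ∫ ω, f (κ x ω) ∂μ) x =
      deriv f 0 • ∫ ω, fderiv ℝ (fun y => κ y ω) x ∂μ := by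
  filter_upwards [h.eventually_hasFDerivAt] with x hx h0
  rw [hx.2.1.fderiv, ← integral_smul]
  refine integral_congr_ae ?_
  filter_upwards [h0] with ω hω
  rw [← hω] at hf ⊢
  exact (hf.hasDerivAt.comp_hasFDerivAt x
    ((hκ ω).differentiable (by norm_num) x).hasFDerivAt).fderiv

/-- Integrability is asserted for the whole sum only. Taking for `f` the square and the identity
later isolates the two summands. -/
theorem DominatedC2.fderiv_fderiv_integral_comp {κ : E → Ω → ℝ} {f : ℝ → ℝ} {x₀ : E}
    (h : DominatedC2 μ (fun x ω => f (κ x ω)) x₀) (hκ : ∀ ω, ContDiff ℝ 2 fun x => κ x ω)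
    (hf : ContDiffAt ℝ 2 f 0) (h0 : ∀ᵐ ω ∂μ, κ x₀ ω = 0) (u v : E) :
    Integrable (fun ω => iteratedDeriv 2 f 0 *
      (fderiv ℝ (fun y => κ y ω) x₀ u * fderiv ℝ (fun y => κ y ω) x₀ v) +
        deriv f 0 * fderiv ℝ (fderiv ℝ fun y => κ y ω) x₀ u v) μ ∧
    fderiv ℝ (fderiv ℝ fun x => ∫ ω, f (κ x ω) ∂μ) x₀ u v = ∫ ω, (iteratedDeriv 2 f 0 *
      (fderiv ℝ (fun y => κ y ω) x₀ u * fderiv ℝ (fun y => κ y ω) x₀ v) +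
        deriv f 0 * fderiv ℝ (fderiv ℝ fun y => κ y ω) x₀ u v) ∂μ := by
  obtain ⟨r, hr, -, -, -, hd, hi2, hd2, -⟩ := h.exists_ball
  have hx := Metric.mem_ball_self (x := x₀) hr
  have hae : (fun ω => fderiv ℝ (fderiv ℝ fun y => f (κ y ω)) x₀ u v) =ᵐ[μ] fun ω =>
      iteratedDeriv 2 f 0 * (fderiv ℝ (fun y => κ y ω) x₀ u * fderiv ℝ (fun y => κ y ω) x₀ v) +
        deriv f 0 * fderiv ℝ (fderiv ℝ fun y => κ y ω) x₀ u v := by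
    filter_upwards [h0] with ω hω
    exact fderiv_fderiv_comp_of_eq_zero hf (hκ ω) hω u v
  have hi := hi2 x₀ hx
  have hiu := hi.apply_continuousLinearMap u
  refine ⟨(hiu.apply_continuousLinearMap v).congr hae, ?_⟩
  have h1 : (fderiv ℝ fun x => ∫ ω, f (κ x ω) ∂μ) =ᶠ[𝓝 x₀]
      fun x => ∫ ω, fderiv ℝ (fun y => f (κ y ω)) x ∂μ := by
    filter_upwards [Metric.ball_mem_nhds x₀ hr] with x hx using (hd x hx).fderiv
  rw [((hd2 x₀ hx).congr_of_eventuallyEq h1).fderiv, ContinuousLinearMap.integral_apply hi,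
    ContinuousLinearMap.integral_apply hiu]
  exact integral_congr_ae hae

end Calculus

/-! ### The losses on the manifolds of equilibria, to first order. -/

namespace ParametricGAN

set_option maxSynthPendingDepth 3

open scoped InnerProductSpace

variable {dφ dθ n : ℕ} {Z : Type*} [MeasurableSpace Z] {M : ParametricGAN dφ dθ n Z}
  {φs : EuclideanSpace ℝ (Fin dφ)} {θs : EuclideanSpace ℝ (Fin dθ)}

/-- `E_{pz}[f(D_φ(G_θ(z)))]` as a function of `(φ, θ)`. -/
def fakeLoss (M : ParametricGAN dφ dθ n Z) (f : ℝ → ℝ)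
    (y : EuclideanSpace ℝ (Fin dφ) × EuclideanSpace ℝ (Fin dθ)) : ℝ :=
  ∫ z, f (M.D y.1 (M.G y.2 z)) ∂M.pz

/-- `E_p[h₁(D_φ(x))]` as a function of `φ`. -/
def realLoss (M : ParametricGAN dφ dθ n Z) (φ : EuclideanSpace ℝ (Fin dφ)) : ℝ :=
  ∫ x, M.h₁ (M.D φ x) ∂M.p

theorem Realizable.mem_discManifold (h1 : M.Realizable φs θs) :
    φs ∈ M.discManifold := by
  obtain ⟨-, U, -, hU, h0⟩ := h1
  have h2 : (fun x => M.D φs x ^ 2) =ᵐ[M.p] 0 := by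
    filter_upwards [M.p.support_mem_ae] with x hx
    simp [h0 x (hU hx)]
  exact ⟨(integrable_zero _ _ _).congr h2.symm, integral_eq_zero_of_ae h2⟩

namespace Regular

theorem contDiff_D_comp_G (hreg : M.Regular φs θs) (z : Z) :
    ContDiff ℝ 2 fun y : EuclideanSpace ℝ (Fin dφ) × EuclideanSpace ℝ (Fin dθ) =>
      M.D y.1 (M.G y.2 z) :=
  hreg.contDiff_D.comp (contDiff_fst.prodMk ((hreg.contDiff_G z).comp contDiff_snd))

theorem contDiff_D_right (hreg : M.Regular φs θs) (φ : EuclideanSpace ℝ (Fin dφ)) :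
    ContDiff ℝ 2 (M.D φ) :=
  hreg.contDiff_D.comp (contDiff_const.prodMk contDiff_id)

theorem contDiff_D_left (hreg : M.Regular φs θs) (x : EuclideanSpace ℝ (Fin n)) :
    ContDiff ℝ 2 fun φ => M.D φ x :=
  hreg.contDiff_D.comp (contDiff_id.prodMk contDiff_const)

theorem aestronglyMeasurable_comp_D (hreg : M.Regular φs θs) {f : ℝ → ℝ} (hf : Measurable f)
    (φ : EuclideanSpace ℝ (Fin dφ)) (ν : Measure (EuclideanSpace ℝ (Fin n))) :
    AEStronglyMeasurable (fun x => f (M.D φ x)) ν :=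
  (hf.comp (hreg.contDiff_D_right φ).continuous.measurable).aestronglyMeasurable

theorem integral_genLaw (hreg : M.Regular φs θs) {f : ℝ → ℝ} (hf : Measurable f)
    (φ : EuclideanSpace ℝ (Fin dφ)) (θ : EuclideanSpace ℝ (Fin dθ)) :
    ∫ x, f (M.D φ x) ∂M.genLaw θ = M.fakeLoss f (φ, θ) :=
  integral_map (hreg.measurable_G θ).aemeasurable (hreg.aestronglyMeasurable_comp_D hf φ _)

theorem integrable_genLaw_iff (hreg : M.Regular φs θs) {f : ℝ → ℝ} (hf : Measurable f)
    (φ : EuclideanSpace ℝ (Fin dφ)) (θ : EuclideanSpace ℝ (Fin dθ)) :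
    Integrable (fun x => f (M.D φ x)) (M.genLaw θ) ↔
      Integrable (fun z => f (M.D φ (M.G θ z))) M.pz :=
  integrable_map_measure (hreg.aestronglyMeasurable_comp_D hf φ _)
    (hreg.measurable_G θ).aemeasurable

theorem integral_p (hreg : M.Regular φs θs) {f : ℝ → ℝ} (hf : Measurable f)
    (φ : EuclideanSpace ℝ (Fin dφ)) {θ : EuclideanSpace ℝ (Fin dθ)} (hθ : θ ∈ M.genManifold) :
    ∫ x, f (M.D φ x) ∂M.p = M.fakeLoss f (φ, θ) := by
  rw [← hreg.integral_genLaw hf, show M.genLaw θ = M.p from hθ]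

theorem ae_pz_of_ae_p (hreg : M.Regular φs θs) {θ : EuclideanSpace ℝ (Fin dθ)}
    (hθ : θ ∈ M.genManifold) {q : EuclideanSpace ℝ (Fin n) → Prop} (h : ∀ᵐ x ∂M.p, q x) :
    ∀ᵐ z ∂M.pz, q (M.G θ z) :=
  ae_of_ae_map (hreg.measurable_G θ).aemeasurable (by rwa [← show M.genLaw θ = M.p from hθ] at h)

/-- The density of `p` enters here: `D φ` need not vanish on an open set for a general `φ`, but its
derivative is zero at Lebesgue-almost every zero. -/
theorem ae_p_eq_zero (hreg : M.Regular φs θs) {φ : EuclideanSpace ℝ (Fin dφ)}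
    (hφ : φ ∈ M.discManifold) : ∀ᵐ x ∂M.p, M.D φ x = 0 ∧ fderiv ℝ (M.D φ) x = 0 := by
  have h1 := (integral_eq_zero_iff_of_nonneg (fun x => sq_nonneg (M.D φ x)) hφ.1).1 hφ.2
  have h2 := hreg.density.ae_le (ae_fderiv_eq_zero_of_eq_zero volume
    ((hreg.contDiff_D_right φ).differentiable (by norm_num)))
  filter_upwards [h1, h2] with x hx1 hx2
  have h0 : M.D φ x = 0 := pow_eq_zero_iff two_ne_zero |>.1 hx1
  exact ⟨h0, hx2 h0⟩

theorem ae_pz_eq_zero (hreg : M.Regular φs θs)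
    {y : EuclideanSpace ℝ (Fin dφ) × EuclideanSpace ℝ (Fin dθ)} (hφ : y.1 ∈ M.discManifold)
    (hθ : y.2 ∈ M.genManifold) : ∀ᵐ z ∂M.pz, M.D y.1 (M.G y.2 z) = 0 ∧
      ∀ w, fderiv ℝ (fun y : EuclideanSpace ℝ (Fin dφ) × EuclideanSpace ℝ (Fin dθ) =>
        M.D y.1 (M.G y.2 z)) y (0, w) = 0 := by
  obtain ⟨φ, θ⟩ := y
  filter_upwards [hreg.ae_pz_of_ae_p hθ (hreg.ae_p_eq_zero hφ)] with z hz
  refine ⟨hz.1, fun w => ?_⟩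
  have h1 := (((hreg.contDiff_D_comp_G z).differentiable (by norm_num)) (φ, θ)).hasFDerivAt.comp θ
    (hasFDerivAt_prodMk_right φ θ)
  have h2 := ((hreg.contDiff_D_right φ).differentiable (by norm_num) (M.G θ z)).hasFDerivAt.comp θ
    ((hreg.contDiff_G z).differentiable (by norm_num) θ).hasFDerivAt
  have h3 := congrArg (fun l : EuclideanSpace ℝ (Fin dθ) →L[ℝ] ℝ => l w) (h1.unique h2)
  simpa [hz.2] using h3

/-- Almost every generated sample lies in the support of `p`, and for nearby `θ` it remains in the
open set where `D φs` is zero. -/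
theorem ae_pz_star (hreg : M.Regular φs θs) (h1 : M.Realizable φs θs) :
    ∀ᵐ z ∂M.pz, ∀ w,
      fderiv ℝ (fun y : EuclideanSpace ℝ (Fin dφ) × EuclideanSpace ℝ (Fin dθ) =>
        M.D y.1 (M.G y.2 z)) (φs, θs) (0, w) = 0 ∧
      ∀ w', fderiv ℝ (fderiv ℝ
        (fun y : EuclideanSpace ℝ (Fin dφ) × EuclideanSpace ℝ (Fin dθ) =>
          M.D y.1 (M.G y.2 z))) (φs, θs) (0, w) (0, w') = 0 := by
  obtain ⟨hθ, U, hUo, hU, h0⟩ := h1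
  filter_upwards [hreg.ae_pz_of_ae_p hθ M.p.support_mem_ae] with z hz w
  refine fderiv_snd_eq_zero_of_eventually (hreg.contDiff_D_comp_G z) ?_ w
  filter_upwards [(hreg.contDiff_G z).continuous.continuousAt.eventually
    (hUo.mem_nhds (hU hz))] with θ hθ
  exact h0 _ hθ

theorem dom_id (hreg : M.Regular φs θs) : DominatedC2 M.pz
    (fun (y : EuclideanSpace ℝ (Fin dφ) × EuclideanSpace ℝ (Fin dθ)) z => M.D y.1 (M.G y.2 z))
    (φs, θs) :=
  hreg.dom_fake (fun u => u) (by simp)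

theorem dom_sq (hreg : M.Regular φs θs) : DominatedC2 M.pz
    (fun (y : EuclideanSpace ℝ (Fin dφ) × EuclideanSpace ℝ (Fin dθ)) z =>
      M.D y.1 (M.G y.2 z) ^ 2) (φs, θs) :=
  hreg.dom_fake (fun u => u ^ 2) (by simp)

/-- Real samples have the law of `G_θs(z)`, so the real loss can be treated on the latent space,
side by side with the fake ones. -/
theorem dom_real_pz (hreg : M.Regular φs θs) (hθ : θs ∈ M.genManifold) :
    DominatedC2 M.pz (fun φ z => M.h₁ (M.D φ (M.G θs z))) φs := by
  have hp : M.pz.map (M.G θs) = M.p := hθ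
  obtain ⟨r, hr, -, K, hK, hae⟩ := hreg.dom_real
  refine ⟨r, hr, fun φ _ => ?_, fun z => K (M.G θs z), ?_, hreg.ae_pz_of_ae_p hθ hae⟩
  · exact (hreg.aestronglyMeasurable_comp_D hreg.measurable_h.1 φ
      (M.pz.map (M.G θs))).comp_measurable (hreg.measurable_G θs)
  · rw [← hp] at hK
    exact hK.comp_measurable (hreg.measurable_G θs)

theorem realLoss_eq (hreg : M.Regular φs θs) (hθ : θs ∈ M.genManifold) :
    M.realLoss = fun φ => ∫ z, M.h₁ (M.D φ (M.G θs z)) ∂M.pz :=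
  funext fun φ => hreg.integral_p hreg.measurable_h.1 φ hθ

/-- The first order behaviour of the losses on the manifold of equilibria. -/
theorem fderiv_fakeLoss (hreg : M.Regular φs θs) {f : ℝ → ℝ}
    (hf : f ∈ ({M.h₂, M.h₃, fun u => u, fun u => u ^ 2} : Set (ℝ → ℝ)))
    (hfd : DifferentiableAt ℝ f 0) :
    ∀ᶠ y in 𝓝 (φs, θs), y.1 ∈ M.discManifold → y.2 ∈ M.genManifold →
      fderiv ℝ (M.fakeLoss f) y = deriv f 0 • fderiv ℝ (M.fakeLoss fun u => u) y ∧
      ∀ w, fderiv ℝ (M.fakeLoss f) y (0, w) = 0 := by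
  filter_upwards [(hreg.dom_fake f hf).fderiv_integral_comp hreg.contDiff_D_comp_G hfd,
    hreg.dom_id.eventually_hasFDerivAt] with y hy hid hφ hθ
  have h0 := hreg.ae_pz_eq_zero hφ hθ
  have h1 : fderiv ℝ (M.fakeLoss f) y = _ := hy (h0.mono fun z hz => hz.1)
  have h2 : fderiv ℝ (M.fakeLoss fun u => u) y = _ := hid.2.1.fderiv
  refine ⟨by rw [h1, h2], fun w => ?_⟩
  rw [h1, smul_apply, ContinuousLinearMap.integral_apply hid.2.2,
    integral_eq_zero_of_ae (h0.mono fun z hz => hz.2 w), smul_zero]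

theorem fderiv_realLoss (hreg : M.Regular φs θs) (hθs : θs ∈ M.genManifold) :
    ∀ᶠ y in 𝓝 (φs, θs), y.1 ∈ M.discManifold → y.2 ∈ M.genManifold →
      fderiv ℝ M.realLoss y.1 = deriv M.h₁ 0 •
        (fderiv ℝ (M.fakeLoss fun u => u) y).comp (ContinuousLinearMap.inl ℝ _ _) := by
  have hc : Tendsto (fun y : EuclideanSpace ℝ (Fin dφ) × EuclideanSpace ℝ (Fin dθ) => (y.1, θs))
      (𝓝 (φs, θs)) (𝓝 (φs, θs)) :=
    (continuous_fst.prodMk continuous_const).tendsto (φs, θs)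
  filter_upwards [continuous_fst.continuousAt.eventually
    ((hreg.dom_real_pz hθs).fderiv_integral_comp (κ := fun φ z => M.D φ (M.G θs z))
      (fun z => hreg.contDiff_D_left (M.G θs z))
      (hreg.contDiffAt_h.1.differentiableAt (by norm_num))),
    hreg.dom_id.eventually_hasFDerivAt, hc.eventually hreg.dom_id.eventually_hasFDerivAt]
    with y hy hid hid' hφ hθ
  have h0 := hreg.ae_pz_eq_zero (y := (y.1, θs)) hφ hθs
  rw [hreg.realLoss_eq hθs, hy (h0.mono fun z hz => hz.1)]
  congr 1
  have e1 : ∀ z, fderiv ℝ (fun φ => M.D φ (M.G θs z)) y.1 =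
      (fderiv ℝ (fun y : EuclideanSpace ℝ (Fin dφ) × EuclideanSpace ℝ (Fin dθ) =>
        M.D y.1 (M.G y.2 z)) (y.1, θs)).comp (ContinuousLinearMap.inl ℝ _ _) := fun z => by
    have h1 := ((hreg.contDiff_D_comp_G z).differentiable (by norm_num) (y.1, θs)).hasFDerivAt
    exact h1.comp_prodMk_left.fderiv
  have e2 : fderiv ℝ (fun φ => M.fakeLoss (fun u => u) (φ, θs)) y.1 =
      (∫ z, fderiv ℝ (fun y : EuclideanSpace ℝ (Fin dφ) × EuclideanSpace ℝ (Fin dθ) =>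
        M.D y.1 (M.G y.2 z)) (y.1, θs) ∂M.pz).comp (ContinuousLinearMap.inl ℝ _ _) :=
    hid'.2.1.comp_prodMk_left.fderiv
  -- Both generators have law `p`, so the two expectations agree as functions of `φ`, and so do
  -- their derivatives.
  have e3 : (fun φ => M.fakeLoss (fun u => u) (φ, θs)) =
      fun φ => M.fakeLoss (fun u => u) (φ, y.2) := by
    funext φ
    exact (hreg.integral_p (f := fun u => u) measurable_id φ hθs).symm.trans
      (hreg.integral_p measurable_id φ hθ)
  have e4 : fderiv ℝ (fun φ => M.fakeLoss (fun u => u) (φ, y.2)) y.1 =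
      (fderiv ℝ (M.fakeLoss fun u => u) y).comp (ContinuousLinearMap.inl ℝ _ _) := by
    have h1 : HasFDerivAt (M.fakeLoss fun u => u) (fderiv ℝ (M.fakeLoss fun u => u) (y.1, y.2))
      (y.1, y.2) := hid.2.1.differentiableAt.hasFDerivAt
    exact h1.comp_prodMk_left.fderiv
  rw [← e4, ← e3, e2]
  simp only [e1]
  ext v
  rw [ContinuousLinearMap.integral_apply, ContinuousLinearMap.comp_apply,
    ContinuousLinearMap.integral_apply hid'.2.2]
  · rfl
  · exact (ContinuousLinearMap.precomp ℝ (ContinuousLinearMap.inl ℝ (EuclideanSpace ℝ (Fin dφ))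
      (EuclideanSpace ℝ (Fin dθ)))).integrable_comp hid'.2.2

end Regular

end ParametricGAN

/-! ### The Hessians of the losses at the equilibrium. -/

namespace ParametricGAN

set_option maxSynthPendingDepth 3

open scoped InnerProductSpace

variable {dφ dθ n : ℕ} {Z : Type*} [MeasurableSpace Z] {M : ParametricGAN dφ dθ n Z}
  {φs : EuclideanSpace ℝ (Fin dφ)} {θs : EuclideanSpace ℝ (Fin dθ)}

/-- Half the Hessian in `φ` of `E_p[D_φ²]` at the equilibrium. -/
def discHess (M : ParametricGAN dφ dθ n Z) (φs : EuclideanSpace ℝ (Fin dφ))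
    (θs : EuclideanSpace ℝ (Fin dθ)) : EuclideanSpace ℝ (Fin dφ) →L[ℝ] EuclideanSpace ℝ (Fin dφ) :=
  (1 / 2 : ℝ) • (rieszVector _ ∘L ContinuousLinearMap.precomp ℝ (ContinuousLinearMap.inl ℝ _ _) ∘L
    fderiv ℝ (fderiv ℝ (M.fakeLoss fun u => u ^ 2)) (φs, θs) ∘L ContinuousLinearMap.inl ℝ _ _)

/-- The mixed second derivative of `E_{pz}[D_φ(G_θ(z))]` at the equilibrium. -/
def coupling (M : ParametricGAN dφ dθ n Z) (φs : EuclideanSpace ℝ (Fin dφ))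
    (θs : EuclideanSpace ℝ (Fin dθ)) : EuclideanSpace ℝ (Fin dθ) →L[ℝ] EuclideanSpace ℝ (Fin dφ) :=
  rieszVector _ ∘L ContinuousLinearMap.precomp ℝ (ContinuousLinearMap.inl ℝ _ _) ∘L
    fderiv ℝ (fderiv ℝ (M.fakeLoss fun u => u)) (φs, θs) ∘L ContinuousLinearMap.inr ℝ _ _

theorem inner_discHess (v v' : EuclideanSpace ℝ (Fin dφ)) : ⟪M.discHess φs θs v, v'⟫_ℝ =
    1 / 2 * fderiv ℝ (fderiv ℝ (M.fakeLoss fun u => u ^ 2)) (φs, θs) (v, 0) (v', 0) := by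
  have : M.discHess φs θs v = (1 / 2 : ℝ) • rieszVector _ ((fderiv ℝ (fderiv ℝ
    (M.fakeLoss fun u => u ^ 2)) (φs, θs) (v, 0)).comp (ContinuousLinearMap.inl ℝ _ _)) := rfl
  rw [this, real_inner_smul_left, inner_rieszVector]
  rfl

theorem inner_coupling (w : EuclideanSpace ℝ (Fin dθ)) (v : EuclideanSpace ℝ (Fin dφ)) :
    ⟪M.coupling φs θs w, v⟫_ℝ =
      fderiv ℝ (fderiv ℝ (M.fakeLoss fun u => u)) (φs, θs) (0, w) (v, 0) :=
  inner_rieszVector _ _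

namespace Regular

section Hessian

variable (hreg : M.Regular φs θs) (h1 : M.Realizable φs θs)
  (u v : EuclideanSpace ℝ (Fin dφ) × EuclideanSpace ℝ (Fin dθ))
include hreg h1

theorem hess_sq : Integrable (fun z =>
      fderiv ℝ (fun y : EuclideanSpace ℝ (Fin dφ) × EuclideanSpace ℝ (Fin dθ) =>
        M.D y.1 (M.G y.2 z)) (φs, θs) u *
      fderiv ℝ (fun y : EuclideanSpace ℝ (Fin dφ) × EuclideanSpace ℝ (Fin dθ) =>
        M.D y.1 (M.G y.2 z)) (φs, θs) v) M.pz ∧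
    fderiv ℝ (fderiv ℝ (M.fakeLoss fun u => u ^ 2)) (φs, θs) u v = 2 * ∫ z,
      fderiv ℝ (fun y : EuclideanSpace ℝ (Fin dφ) × EuclideanSpace ℝ (Fin dθ) =>
        M.D y.1 (M.G y.2 z)) (φs, θs) u *
      fderiv ℝ (fun y : EuclideanSpace ℝ (Fin dφ) × EuclideanSpace ℝ (Fin dθ) =>
        M.D y.1 (M.G y.2 z)) (φs, θs) v ∂M.pz := by
  have h0 := (hreg.ae_pz_eq_zero (y := (φs, θs)) h1.mem_discManifold h1.1).mono fun z hz => hz.1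
  obtain ⟨hi, he⟩ := DominatedC2.fderiv_fderiv_integral_comp (f := fun u => u ^ 2) hreg.dom_sq
    hreg.contDiff_D_comp_G (contDiff_id.pow 2).contDiffAt h0 u v
  have d1 : deriv (fun u : ℝ => u ^ 2) 0 = 0 := by simp
  have d2 : iteratedDeriv 2 (fun u : ℝ => u ^ 2) 0 = 2 := by
    rw [iteratedDeriv_succ, iteratedDeriv_one]
    have : deriv (fun u : ℝ => u ^ 2) = fun u => 2 * u := by ext u; simp
    rw [this, deriv_const_mul_field]
    simp
  simp only [d1, d2, zero_mul, add_zero] at hi he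
  refine ⟨(hi.const_mul (1 / 2)).congr (Eventually.of_forall fun z => by simp), ?_⟩
  rw [integral_const_mul] at he
  exact he

theorem hess_id : Integrable (fun z => fderiv ℝ (fderiv ℝ
      fun y : EuclideanSpace ℝ (Fin dφ) × EuclideanSpace ℝ (Fin dθ) =>
        M.D y.1 (M.G y.2 z)) (φs, θs) u v) M.pz ∧
    fderiv ℝ (fderiv ℝ (M.fakeLoss fun u => u)) (φs, θs) u v = ∫ z, fderiv ℝ (fderiv ℝ
      fun y : EuclideanSpace ℝ (Fin dφ) × EuclideanSpace ℝ (Fin dθ) =>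
        M.D y.1 (M.G y.2 z)) (φs, θs) u v ∂M.pz := by
  have h0 := (hreg.ae_pz_eq_zero (y := (φs, θs)) h1.mem_discManifold h1.1).mono fun z hz => hz.1
  obtain ⟨hi, he⟩ := DominatedC2.fderiv_fderiv_integral_comp (f := fun u => u) hreg.dom_id
    hreg.contDiff_D_comp_G contDiffAt_id h0 u v
  have d1 : deriv (fun u : ℝ => u) 0 = 1 := by simp
  have d2 : iteratedDeriv 2 (fun u : ℝ => u) 0 = 0 := by
    rw [iteratedDeriv_succ, iteratedDeriv_one]
    simp
  simp only [d1, d2, zero_mul, zero_add, one_mul] at hi he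
  exact ⟨hi, he⟩

theorem integral_hess_eq (a b : ℝ) : ∫ z, (a * (
      fderiv ℝ (fun y : EuclideanSpace ℝ (Fin dφ) × EuclideanSpace ℝ (Fin dθ) =>
        M.D y.1 (M.G y.2 z)) (φs, θs) u *
      fderiv ℝ (fun y : EuclideanSpace ℝ (Fin dφ) × EuclideanSpace ℝ (Fin dθ) =>
        M.D y.1 (M.G y.2 z)) (φs, θs) v) + b * fderiv ℝ (fderiv ℝ
      fun y : EuclideanSpace ℝ (Fin dφ) × EuclideanSpace ℝ (Fin dθ) =>
        M.D y.1 (M.G y.2 z)) (φs, θs) u v) ∂M.pz =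
    a / 2 * fderiv ℝ (fderiv ℝ (M.fakeLoss fun u => u ^ 2)) (φs, θs) u v +
      b * fderiv ℝ (fderiv ℝ (M.fakeLoss fun u => u)) (φs, θs) u v := by
  obtain ⟨i1, e1⟩ := hreg.hess_sq h1 u v
  obtain ⟨i2, e2⟩ := hreg.hess_id h1 u v
  rw [integral_add (i1.const_mul a) (i2.const_mul b), integral_const_mul, integral_const_mul, e1,
    e2]
  ring

/-- Every Hessian is a combination of two: that of the square, carrying ∂D ⊗ ∂D, and that of the
identity, carrying ∂²D. -/
theorem hess_fakeLoss {f : ℝ → ℝ}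
    (hf : f ∈ ({M.h₂, M.h₃, fun u => u, fun u => u ^ 2} : Set (ℝ → ℝ))) (hfc : ContDiffAt ℝ 2 f 0) :
    fderiv ℝ (fderiv ℝ (M.fakeLoss f)) (φs, θs) u v = iteratedDeriv 2 f 0 / 2 *
      fderiv ℝ (fderiv ℝ (M.fakeLoss fun u => u ^ 2)) (φs, θs) u v +
      deriv f 0 * fderiv ℝ (fderiv ℝ (M.fakeLoss fun u => u)) (φs, θs) u v := by
  have h0 := (hreg.ae_pz_eq_zero (y := (φs, θs)) h1.mem_discManifold h1.1).mono fun z hz => hz.1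
  rw [← hreg.integral_hess_eq h1]
  exact ((hreg.dom_fake f hf).fderiv_fderiv_integral_comp hreg.contDiff_D_comp_G hfc h0 u v).2

theorem hess_realLoss (v v' : EuclideanSpace ℝ (Fin dφ)) :
    fderiv ℝ (fderiv ℝ M.realLoss) φs v v' = iteratedDeriv 2 M.h₁ 0 / 2 *
      fderiv ℝ (fderiv ℝ (M.fakeLoss fun u => u ^ 2)) (φs, θs) (v, 0) (v', 0) +
      deriv M.h₁ 0 * fderiv ℝ (fderiv ℝ (M.fakeLoss fun u => u)) (φs, θs) (v, 0) (v', 0) := by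
  have h0 := (hreg.ae_pz_eq_zero (y := (φs, θs)) h1.mem_discManifold h1.1).mono fun z hz => hz.1
  rw [← hreg.integral_hess_eq h1, hreg.realLoss_eq h1.1,
    ((hreg.dom_real_pz h1.1).fderiv_fderiv_integral_comp (κ := fun φ z => M.D φ (M.G θs z))
      (fun z => hreg.contDiff_D_left (M.G θs z)) hreg.contDiffAt_h.1 h0 v v').2]
  congr 1
  funext z
  have hk := hreg.contDiff_D_comp_G z
  have e1 : ∀ φ v, fderiv ℝ (fun φ => M.D φ (M.G θs z)) φ v =
      fderiv ℝ (fun y : EuclideanSpace ℝ (Fin dφ) × EuclideanSpace ℝ (Fin dθ) =>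
        M.D y.1 (M.G y.2 z)) (φ, θs) (v, 0) := fun φ v => by
    have h2 := (hk.differentiable (by norm_num) (φ, θs)).hasFDerivAt
    have h3 : HasFDerivAt (fun φ => M.D φ (M.G θs z)) _ φ :=
      h2.comp_prodMk_left
    rw [h3.fderiv]
    rfl
  have e2 : fderiv ℝ (fderiv ℝ fun φ => M.D φ (M.G θs z)) φs v v' =
      fderiv ℝ (fderiv ℝ fun y : EuclideanSpace ℝ (Fin dφ) × EuclideanSpace ℝ (Fin dθ) =>
        M.D y.1 (M.G y.2 z)) (φs, θs) (v, 0) (v', 0) := by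
    have d1 : DifferentiableAt ℝ (fderiv ℝ fun φ => M.D φ (M.G θs z)) φs :=
      ((hreg.contDiff_D_left (M.G θs z)).fderiv_right (m := 1) (by norm_num)).differentiable
        one_ne_zero φs
    have h2 := ((hk.fderiv_right (m := 1) (by norm_num)).differentiable
      one_ne_zero (φs, θs)).hasFDerivAt
    have h3 := h2.comp_prodMk_left.clm_apply
      (hasFDerivAt_const (v', (0 : EuclideanSpace ℝ (Fin dθ))) φs)
    have h4 := d1.hasFDerivAt.clm_apply (hasFDerivAt_const v' φs)
    have h5 : (fun φ => fderiv ℝ (fun φ => M.D φ (M.G θs z)) φ v') = fun φ =>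
      fderiv ℝ (fun y : EuclideanSpace ℝ (Fin dφ) × EuclideanSpace ℝ (Fin dθ) =>
        M.D y.1 (M.G y.2 z)) (φ, θs) (v', 0) := funext fun φ => e1 φ v'
    rw [h5] at h4
    have := congrArg (fun l : EuclideanSpace ℝ (Fin dφ) →L[ℝ] ℝ => l v) (h4.unique h3)
    simpa using this
  rw [e1, e1, e2]

/-- Each entry is the mean of a product of first derivatives, and the one in θ is almost surely
zero. Hence the penalty does not feel the generator to first order. -/
theorem hess_sq_snd (w : EuclideanSpace ℝ (Fin dθ)) :
    fderiv ℝ (fderiv ℝ (M.fakeLoss fun u => u ^ 2)) (φs, θs) (0, w) v = 0 ∧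
    fderiv ℝ (fderiv ℝ (M.fakeLoss fun u => u ^ 2)) (φs, θs) v (0, w) = 0 := by
  have h0 := hreg.ae_pz_star h1
  rw [(hreg.hess_sq h1 _ _).2, (hreg.hess_sq h1 _ _).2]
  constructor
  · rw [integral_eq_zero_of_ae (h0.mono fun z hz => by simp [(hz w).1]), mul_zero]
  · rw [integral_eq_zero_of_ae (h0.mono fun z hz => by simp [(hz w).1]), mul_zero]

theorem hess_id_snd_snd (w w' : EuclideanSpace ℝ (Fin dθ)) :
    fderiv ℝ (fderiv ℝ (M.fakeLoss fun u => u)) (φs, θs) (0, w) (0, w') = 0 := by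
  rw [(hreg.hess_id h1 _ _).2]
  exact integral_eq_zero_of_ae ((hreg.ae_pz_star h1).mono fun z hz => (hz w).2 w')

end Hessian

theorem hess_id_symm (hreg : M.Regular φs θs)
    (u v : EuclideanSpace ℝ (Fin dφ) × EuclideanSpace ℝ (Fin dθ)) :
    fderiv ℝ (fderiv ℝ (M.fakeLoss fun u => u)) (φs, θs) u v =
      fderiv ℝ (fderiv ℝ (M.fakeLoss fun u => u)) (φs, θs) v u :=
  (hreg.dom_id.contDiffAt_integral.isSymmSndFDerivAt (by simp)).eq u v

end Regular

end ParametricGAN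

/-! ### Derivatives along tangent vectors and along lines. -/

section TangentVectors

set_option maxSynthPendingDepth 3

variable {E : Type*} [NormedAddCommGroup E] [NormedSpace ℝ E]

theorem HasFDerivAt.apply_eq_zero_of_mem_tangentVectors {H : Type*} [NormedAddCommGroup H]
    [NormedSpace ℝ H] {f : E → H} {L : E →L[ℝ] H} {x v : E} {S : Set E} {c : H}
    (hf : HasFDerivAt f L x) (h0 : ∀ᶠ y in 𝓝 x, y ∈ S → f y = c) (hv : v ∈ tangentVectors S x) :
    L v = 0 := by
  obtain ⟨γ, rfl, hγ, hS, rfl⟩ := hv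
  have h1 := hf.comp_hasDerivAt (0 : ℝ) (hγ.differentiableAt one_ne_zero).hasDerivAt
  have h2 : HasDerivAt (f ∘ γ) 0 0 := by
    refine (hasDerivAt_const (0 : ℝ) c).congr_of_eventuallyEq ?_
    filter_upwards [hS, hγ.continuousAt.eventually h0] with t ht htc
    exact htc ht
  exact h1.unique h2

theorem ContDiffAt.iteratedDeriv_two_line {F : E → ℝ} {x : E} (hF : ContDiffAt ℝ 2 F x) (v : E) :
    iteratedDeriv 2 (fun t : ℝ => F (x + t • v)) 0 = fderiv ℝ (fderiv ℝ F) x v v := by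
  have hl : ∀ t : ℝ, HasDerivAt (fun t : ℝ => x + t • v) v t := fun t => by
    simpa using ((hasDerivAt_id t).smul_const v).const_add x
  have hx : x + (0 : ℝ) • v = x := by simp
  have hd : ∀ᶠ y in 𝓝 (x + (0 : ℝ) • v), DifferentiableAt ℝ F y := by
    rw [hx]
    exact (hF.eventually (by simp)).mono fun y hy => hy.differentiableAt (by norm_num)
  have h1 : deriv (fun t : ℝ => F (x + t • v)) =ᶠ[𝓝 0] fun t => fderiv ℝ F (x + t • v) v := by
    filter_upwards [(hl 0).continuousAt.eventually hd] with t ht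
    exact (ht.hasFDerivAt.comp_hasDerivAt t (hl t)).deriv
  have h2 : HasFDerivAt (fderiv ℝ F) (fderiv ℝ (fderiv ℝ F) x) (x + (0 : ℝ) • v) := by
    rw [hx]
    exact ((hF.fderiv_right (m := 1) (by norm_num)).differentiableAt one_ne_zero).hasFDerivAt
  rw [iteratedDeriv_succ, iteratedDeriv_one, h1.deriv_eq]
  have h3 : HasDerivAt (fun t : ℝ => fderiv ℝ F (x + t • v)) (fderiv ℝ (fderiv ℝ F) x v) 0 :=
    h2.comp_hasDerivAt (0 : ℝ) (hl 0)
  exact ((ContinuousLinearMap.apply ℝ ℝ v).hasFDerivAt.comp_hasDerivAt (0 : ℝ) h3).deriv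

end TangentVectors

/-! ### The update fields: zeros, linearization, and the kernels of A and P. -/

namespace ParametricGAN

set_option maxSynthPendingDepth 3

open scoped InnerProductSpace

variable {dφ dθ n : ℕ} {Z : Type*} [MeasurableSpace Z] {M : ParametricGAN dφ dθ n Z}
  {φs : EuclideanSpace ℝ (Fin dφ)} {θs : EuclideanSpace ℝ (Fin dθ)}

/-- The gradient in `φ` of `E_{p_G}[D_φ²]`. -/
def penaltyField (M : ParametricGAN dφ dθ n Z)
    (y : EuclideanSpace ℝ (Fin dφ) × EuclideanSpace ℝ (Fin dθ)) : EuclideanSpace ℝ (Fin dφ) :=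
  rieszVector _ ((fderiv ℝ (M.fakeLoss fun u => u ^ 2) y).comp (ContinuousLinearMap.inl ℝ _ _))

/-- The gradient in `φ` of the unregularized discriminator objective. -/
def discField (M : ParametricGAN dφ dθ n Z)
    (y : EuclideanSpace ℝ (Fin dφ) × EuclideanSpace ℝ (Fin dθ)) : EuclideanSpace ℝ (Fin dφ) :=
  rieszVector _ (fderiv ℝ M.realLoss y.1 +
    (fderiv ℝ (M.fakeLoss M.h₂) y).comp (ContinuousLinearMap.inl ℝ _ _))

/-- The gradient in `θ` of the generator objective. -/
def genField (M : ParametricGAN dφ dθ n Z)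
    (y : EuclideanSpace ℝ (Fin dφ) × EuclideanSpace ℝ (Fin dθ)) : EuclideanSpace ℝ (Fin dθ) :=
  rieszVector _ ((fderiv ℝ (M.fakeLoss M.h₃) y).comp (ContinuousLinearMap.inr ℝ _ _))

namespace Regular

variable (hreg : M.Regular φs θs)
include hreg

theorem penaltyField_eq_zero : ∀ᶠ y in 𝓝 (φs, θs), y.1 ∈ M.discManifold → y.2 ∈ M.genManifold →
    M.penaltyField y = 0 := by
  filter_upwards [hreg.fderiv_fakeLoss (f := fun u => u ^ 2) (by simp) (by fun_prop)]
    with y hy hφ hθ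
  simp [penaltyField, (hy hφ hθ).1]

theorem discField_eq_zero (hθs : θs ∈ M.genManifold) (h3 : M.OutputConditions) :
    ∀ᶠ y in 𝓝 (φs, θs), y.1 ∈ M.discManifold → y.2 ∈ M.genManifold → M.discField y = 0 := by
  have h12 : deriv M.h₂ 0 = -deriv M.h₁ 0 := by
    have h := h3.2.2.2.1
    rw [abs_of_pos h3.1, abs_of_neg h3.2.1] at h
    linarith
  filter_upwards [hreg.fderiv_realLoss hθs, hreg.fderiv_fakeLoss (f := M.h₂) (by simp)
    (hreg.contDiffAt_h.2.1.differentiableAt (by norm_num))] with y hy1 hy2 hφ hθ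
  rw [discField, hy1 hφ hθ, (hy2 hφ hθ).1, h12]
  simp [ContinuousLinearMap.smul_comp]

theorem genField_eq_zero : ∀ᶠ y in 𝓝 (φs, θs), y.1 ∈ M.discManifold → y.2 ∈ M.genManifold →
    M.genField y = 0 := by
  filter_upwards [hreg.fderiv_fakeLoss (f := M.h₃) (by simp)
    (hreg.contDiffAt_h.2.2.differentiableAt (by norm_num))] with y hy hφ hθ
  have : (fderiv ℝ (M.fakeLoss M.h₃) y).comp (ContinuousLinearMap.inr ℝ _ _) = 0 := by
    ext1 w
    simpa using (hy hφ hθ).2 w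
  rw [genField, this, map_zero]

theorem hasStrictFDerivAt_penaltyField (h1 : M.Realizable φs θs) :
    HasStrictFDerivAt M.penaltyField
      ((2 : ℝ) • M.discHess φs θs ∘L ContinuousLinearMap.fst ℝ _ _) (φs, θs) := by
  have h := (rieszVector (EuclideanSpace ℝ (Fin dφ)) ∘L ContinuousLinearMap.precomp ℝ
    (ContinuousLinearMap.inl ℝ (EuclideanSpace ℝ (Fin dφ)) (EuclideanSpace ℝ (Fin dθ)))
    ).hasStrictFDerivAt.comp (φs, θs) hreg.dom_sq.hasStrictFDerivAt_fderiv_integral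
  refine h.congr_fderiv ?_
  refine ContinuousLinearMap.ext fun x => ext_inner_right ℝ fun v' => ?_
  have e1 : ⟪rieszVector _ ((fderiv ℝ (fderiv ℝ (M.fakeLoss fun u => u ^ 2)) (φs, θs) x).comp
      (ContinuousLinearMap.inl ℝ _ _)), v'⟫_ℝ =
      ⟪(2 : ℝ) • M.discHess φs θs x.1, v'⟫_ℝ := by
    have hx : x = (x.1, 0) + (0, x.2) := by simp
    have hs : fderiv ℝ (fderiv ℝ (M.fakeLoss fun u => u ^ 2)) (φs, θs) x (v', 0) =
        fderiv ℝ (fderiv ℝ (M.fakeLoss fun u => u ^ 2)) (φs, θs) (x.1, 0) (v', 0) := by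
      conv_lhs => rw [hx, map_add, add_apply, (hreg.hess_sq_snd h1 _ _).1, add_zero]
    rw [inner_rieszVector, real_inner_smul_left, ContinuousLinearMap.comp_apply,
      ContinuousLinearMap.inl_apply, inner_discHess, hs]
    ring
  exact e1

/-- The indefinite terms with second derivatives of `D` in φ carry the factor h₁'(0) + h₂'(0) = 0;
only the fake loss has a mixed derivative, whence the coupling with its minus sign. -/
theorem hasStrictFDerivAt_discField (h1 : M.Realizable φs θs) (h3 : M.OutputConditions) :
    HasStrictFDerivAt M.discField
      ((iteratedDeriv 2 M.h₁ 0 + iteratedDeriv 2 M.h₂ 0) •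
        M.discHess φs θs ∘L ContinuousLinearMap.fst ℝ _ _ -
        deriv M.h₁ 0 • M.coupling φs θs ∘L ContinuousLinearMap.snd ℝ _ _) (φs, θs) := by
  have h12 : deriv M.h₂ 0 = -deriv M.h₁ 0 := by
    have h := h3.2.2.2.1
    rw [abs_of_pos h3.1, abs_of_neg h3.2.1] at h
    linarith
  have hr : HasStrictFDerivAt (fderiv ℝ M.realLoss) (fderiv ℝ (fderiv ℝ M.realLoss) φs) φs :=
    hreg.dom_real.hasStrictFDerivAt_fderiv_integral
  have hr' : HasStrictFDerivAt (fun y : EuclideanSpace ℝ (Fin dφ) × EuclideanSpace ℝ (Fin dθ) =>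
      fderiv ℝ M.realLoss y.1) ((fderiv ℝ (fderiv ℝ M.realLoss) φs).comp
        (ContinuousLinearMap.fst ℝ _ _)) (φs, θs) :=
    HasStrictFDerivAt.comp (g := fderiv ℝ M.realLoss) (f := Prod.fst) (φs, θs) hr
      hasStrictFDerivAt_fst
  have hf := (ContinuousLinearMap.precomp ℝ
    (ContinuousLinearMap.inl ℝ (EuclideanSpace ℝ (Fin dφ)) (EuclideanSpace ℝ (Fin dθ)))
    ).hasStrictFDerivAt.comp (φs, θs)
      (hreg.dom_fake M.h₂ (by simp)).hasStrictFDerivAt_fderiv_integral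
  have h := (rieszVector (EuclideanSpace ℝ (Fin dφ))).hasStrictFDerivAt.comp (φs, θs) (hr'.add hf)
  refine h.congr_fderiv ?_
  refine ContinuousLinearMap.ext fun x => ext_inner_right ℝ fun v' => ?_
  have e1 : ⟪rieszVector _ (fderiv ℝ (fderiv ℝ M.realLoss) φs x.1 +
      (fderiv ℝ (fderiv ℝ (M.fakeLoss M.h₂)) (φs, θs) x).comp
        (ContinuousLinearMap.inl ℝ _ _)), v'⟫_ℝ =
      ⟪(iteratedDeriv 2 M.h₁ 0 + iteratedDeriv 2 M.h₂ 0) • M.discHess φs θs x.1 -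
        deriv M.h₁ 0 • M.coupling φs θs x.2, v'⟫_ℝ := by
    have hx : x = (x.1, 0) + (0, x.2) := by simp
    have hs : fderiv ℝ (fderiv ℝ (M.fakeLoss fun u => u ^ 2)) (φs, θs) x (v', 0) =
        fderiv ℝ (fderiv ℝ (M.fakeLoss fun u => u ^ 2)) (φs, θs) (x.1, 0) (v', 0) := by
      conv_lhs => rw [hx, map_add, add_apply, (hreg.hess_sq_snd h1 _ _).1, add_zero]
    have hi : fderiv ℝ (fderiv ℝ (M.fakeLoss fun u => u)) (φs, θs) x (v', 0) =
        fderiv ℝ (fderiv ℝ (M.fakeLoss fun u => u)) (φs, θs) (x.1, 0) (v', 0) +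
        fderiv ℝ (fderiv ℝ (M.fakeLoss fun u => u)) (φs, θs) (0, x.2) (v', 0) := by
      conv_lhs => rw [hx, map_add, add_apply]
    rw [inner_rieszVector, add_apply, ContinuousLinearMap.comp_apply,
      ContinuousLinearMap.inl_apply, hreg.hess_realLoss h1,
      hreg.hess_fakeLoss h1 _ _ (by simp) hreg.contDiffAt_h.2.1, inner_sub_left,
      real_inner_smul_left, real_inner_smul_left, inner_discHess, inner_coupling, hs, hi, h12]
    ring
  exact e1

/-- The θ-Hessian vanishes, and symmetry of second derivatives together with h₃'(0) = h₁'(0) makes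
the rest the negative adjoint of the coupling in the discriminator field. -/
theorem hasStrictFDerivAt_genField (h1 : M.Realizable φs θs) (h3 : M.OutputConditions) :
    HasStrictFDerivAt M.genField
      (deriv M.h₁ 0 • (M.coupling φs θs).adjoint ∘L ContinuousLinearMap.fst ℝ _ _) (φs, θs) := by
  have h13 : deriv M.h₃ 0 = deriv M.h₁ 0 := by
    have h := h3.2.2.2.1.trans h3.2.2.2.2
    rw [abs_of_pos h3.1, abs_of_pos h3.2.2.1] at h
    exact h.symm
  have h := (rieszVector (EuclideanSpace ℝ (Fin dθ)) ∘L ContinuousLinearMap.precomp ℝ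
    (ContinuousLinearMap.inr ℝ (EuclideanSpace ℝ (Fin dφ)) (EuclideanSpace ℝ (Fin dθ)))
    ).hasStrictFDerivAt.comp (φs, θs)
      (hreg.dom_fake M.h₃ (by simp)).hasStrictFDerivAt_fderiv_integral
  refine h.congr_fderiv ?_
  refine ContinuousLinearMap.ext fun x => ext_inner_right ℝ fun w => ?_
  have e1 : ⟪rieszVector _ ((fderiv ℝ (fderiv ℝ (M.fakeLoss M.h₃)) (φs, θs) x).comp
      (ContinuousLinearMap.inr ℝ _ _)), w⟫_ℝ =
      ⟪deriv M.h₁ 0 • (M.coupling φs θs).adjoint x.1, w⟫_ℝ := by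
    have hx : x = (x.1, 0) + (0, x.2) := by simp
    have hi : fderiv ℝ (fderiv ℝ (M.fakeLoss fun u => u)) (φs, θs) x (0, w) =
        fderiv ℝ (fderiv ℝ (M.fakeLoss fun u => u)) (φs, θs) (x.1, 0) (0, w) := by
      conv_lhs => rw [hx, map_add, add_apply, hreg.hess_id_snd_snd h1, add_zero]
    rw [inner_rieszVector, ContinuousLinearMap.comp_apply, ContinuousLinearMap.inr_apply,
      hreg.hess_fakeLoss h1 _ _ (by simp) hreg.contDiffAt_h.2.2, (hreg.hess_sq_snd h1 _ _).2, hi,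
      real_inner_smul_left, ContinuousLinearMap.adjoint_inner_left, real_inner_comm,
      inner_coupling, hreg.hess_id_symm, h13]
    ring
  exact e1

theorem discHess_nonneg (h1 : M.Realizable φs θs) (v : EuclideanSpace ℝ (Fin dφ)) :
    0 ≤ ⟪M.discHess φs θs v, v⟫_ℝ := by
  rw [inner_discHess, (hreg.hess_sq h1 _ _).2]
  exact mul_nonneg (by norm_num) (mul_nonneg (by norm_num)
    (integral_nonneg fun z => mul_self_nonneg _))

theorem discHess_symm (h1 : M.Realizable φs θs) (v w : EuclideanSpace ℝ (Fin dφ)) :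
    ⟪M.discHess φs θs v, w⟫_ℝ = ⟪v, M.discHess φs θs w⟫_ℝ := by
  rw [real_inner_comm (M.discHess φs θs w) v, inner_discHess, inner_discHess, (hreg.hess_sq h1 _ _).2,
    (hreg.hess_sq h1 _ _).2]
  simp only [mul_comm]

theorem mem_tangentVectors_discManifold_of_inner_eq_zero (h1 : M.Realizable φs θs)
    (h2 : M.Nondegenerate φs θs) {v : EuclideanSpace ℝ (Fin dφ)}
    (hv : ⟪M.discHess φs θs v, v⟫_ℝ = 0) : v ∈ tangentVectors M.discManifold φs := by
  by_contra hcon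
  refine h2.2.1 v hcon ?_
  have hE : M.discEnergy = fun φ => M.fakeLoss (fun u => u ^ 2) (φ, θs) := funext fun φ =>
    hreg.integral_p (f := fun u => u ^ 2) (measurable_id.pow_const 2) φ h1.1
  have hl : ∀ t : ℝ, ((φs, θs) : EuclideanSpace ℝ (Fin dφ) × EuclideanSpace ℝ (Fin dθ)) +
      t • (v, (0 : EuclideanSpace ℝ (Fin dθ))) = (φs + t • v, θs) := fun t => by simp
  have h3 := hreg.dom_sq.contDiffAt_integral.iteratedDeriv_two_line (v, 0)
  rw [inner_discHess] at hv
  rw [hE]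
  simp only [hl] at h3
  refine h3.trans ?_
  change fderiv ℝ (fderiv ℝ (M.fakeLoss fun u => u ^ 2)) (φs, θs) (v, 0) (v, 0) = 0
  linarith

/-- The penalty field vanishes along the manifold, so its derivative kills tangent vectors; the
converse is nondegeneracy, since the second derivative of h along `v` is 2⟨Av, v⟩. -/
theorem mem_tangentVectors_discManifold_iff (h1 : M.Realizable φs θs) (h2 : M.Nondegenerate φs θs)
    (v : EuclideanSpace ℝ (Fin dφ)) : v ∈ tangentVectors M.discManifold φs ↔
      v ∈ (M.discHess φs θs : EuclideanSpace ℝ (Fin dφ) →ₗ[ℝ] EuclideanSpace ℝ (Fin dφ)).ker := by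
  refine ⟨fun hv => ?_, fun hv => ?_⟩
  · have hc : Tendsto (fun φ => (φ, θs)) (𝓝 φs) (𝓝 (φs, θs)) :=
      (continuous_id.prodMk continuous_const).tendsto φs
    have h := (hreg.hasStrictFDerivAt_penaltyField h1).hasFDerivAt.comp_prodMk_left
      |>.apply_eq_zero_of_mem_tangentVectors
        ((hc.eventually hreg.penaltyField_eq_zero).mono fun φ h hφ => h hφ h1.1) hv
    simpa using h
  · have hv : M.discHess φs θs v = 0 := hv
    exact hreg.mem_tangentVectors_discManifold_of_inner_eq_zero h1 h2 (by rw [hv, inner_zero_left])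

/-- At `θs` the θ-derivative of E[D_φ(G_θ(z))] is zero for every nearby φ in the manifold.
Differentiating along tangent vectors kills the mixed derivative, so P maps into (ker A)ᗮ. -/
theorem inner_coupling_eq_zero (h1 : M.Realizable φs θs) (h2 : M.Nondegenerate φs θs)
    (v : EuclideanSpace ℝ (Fin dφ)) (hv : M.discHess φs θs v = 0) (w : EuclideanSpace ℝ (Fin dθ)) :
    ⟪v, M.coupling φs θs w⟫_ℝ = 0 := by
  have hvt := (hreg.mem_tangentVectors_discManifold_iff h1 h2 v).2 hv
  have hc : Tendsto (fun φ => (φ, θs)) (𝓝 φs) (𝓝 (φs, θs)) :=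
    (continuous_id.prodMk continuous_const).tendsto φs
  have hd : HasFDerivAt (fderiv ℝ (M.fakeLoss fun u => u))
      (fderiv ℝ (fderiv ℝ (M.fakeLoss fun u => u)) (φs, θs)) (φs, θs) :=
    hreg.dom_id.hasStrictFDerivAt_fderiv_integral.hasFDerivAt
  have h := (hd.comp_prodMk_left.clm_apply (hasFDerivAt_const (0, w) φs))
    |>.apply_eq_zero_of_mem_tangentVectors (c := 0) ((hc.eventually (hreg.fderiv_fakeLoss
      (f := fun u => u) (by simp) (by fun_prop))).mono fun φ h hφ => (h hφ h1.1).2 w) hvt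
  rw [real_inner_comm, inner_coupling, hreg.hess_id_symm]
  simpa using h

/-- Near `θs`, g is the φ-gradient at `φs` of E[D_φ(G_θ(z))], so the assumption on g becomes a
statement about ker P. -/
theorem hasFDerivAt_gradMean :
    HasFDerivAt (M.gradMean φs) (M.coupling φs θs) θs := by
  have hd : HasFDerivAt (fderiv ℝ (M.fakeLoss fun u => u))
      (fderiv ℝ (fderiv ℝ (M.fakeLoss fun u => u)) (φs, θs)) (φs, θs) :=
    hreg.dom_id.hasStrictFDerivAt_fderiv_integral.hasFDerivAt
  have hc : Tendsto (fun θ => (φs, θ)) (𝓝 θs) (𝓝 (φs, θs)) :=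
    (continuous_const.prodMk continuous_id).tendsto θs
  have h := (rieszVector (EuclideanSpace ℝ (Fin dφ)) ∘L ContinuousLinearMap.precomp ℝ
    (ContinuousLinearMap.inl ℝ (EuclideanSpace ℝ (Fin dφ)) (EuclideanSpace ℝ (Fin dθ)))
    ).hasFDerivAt.comp θs hd.comp_prodMk_right
  refine (h.congr_of_eventuallyEq ?_)
  filter_upwards [hc.eventually hreg.dom_id.eventually_hasFDerivAt] with θ hθ
  have hD : ∀ x, gradient (fun φ => M.D φ x) φs = rieszVector _
      ((fderiv ℝ (Function.uncurry M.D) (φs, x)).comp (ContinuousLinearMap.inl ℝ _ _)) := fun x =>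
    (((hreg.contDiff_D.differentiable (by norm_num) (φs, x)).hasFDerivAt.comp_prodMk_left
      ).hasGradientAt_rieszVector).gradient
  have hk : ∀ z, gradient (fun φ => M.D φ (M.G θ z)) φs = (rieszVector _ ∘L
      ContinuousLinearMap.precomp ℝ (ContinuousLinearMap.inl ℝ _ _))
      (fderiv ℝ (fun y : EuclideanSpace ℝ (Fin dφ) × EuclideanSpace ℝ (Fin dθ) =>
        M.D y.1 (M.G y.2 z)) (φs, θ)) := fun z =>
    (((hreg.contDiff_D_comp_G z).differentiable (by norm_num) (φs, θ)).hasFDerivAt.comp_prodMk_left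
      ).hasGradientAt_rieszVector.gradient
  have hm : Continuous fun x => gradient (fun φ => M.D φ x) φs := by
    simp only [hD]
    exact (rieszVector _).continuous.comp ((((hreg.contDiff_D.fderiv_right (m := 1)
      (by norm_num)).continuous).comp (Continuous.prodMk_right φs)).clm_comp continuous_const)
  rw [gradMean, genLaw, integral_map (hreg.measurable_G θ).aemeasurable hm.aestronglyMeasurable]
  simp only [hk]
  rw [ContinuousLinearMap.integral_comp_comm _ hθ.2.2]
  congr 1
  exact hθ.2.1.fderiv.symm

theorem mem_tangentVectors_genManifold_iff (h2 : M.Nondegenerate φs θs)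
    (w : EuclideanSpace ℝ (Fin dθ)) : w ∈ tangentVectors M.genManifold θs ↔
      w ∈ (M.coupling φs θs : EuclideanSpace ℝ (Fin dθ) →ₗ[ℝ] EuclideanSpace ℝ (Fin dφ)).ker := by
  have hd := hreg.hasFDerivAt_gradMean
  constructor
  · intro hw
    refine hd.apply_eq_zero_of_mem_tangentVectors (c := ∫ x, gradient (fun φ => M.D φ x) φs ∂M.p)
      (Eventually.of_forall fun θ hθ => ?_) hw
    rw [gradMean, show M.genLaw θ = M.p from hθ]
  · intro hw
    by_contra hcon
    refine h2.2.2 w hcon ?_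
    rw [(hd.hasLineDerivAt w).lineDeriv]
    exact hw

end Regular

end ParametricGAN

/-! ### The gradient with buffers and the field estimates in normal coordinates. -/

namespace ParametricGAN

set_option maxSynthPendingDepth 3

open scoped InnerProductSpace

variable {dφ dθ n : ℕ} {Z : Type*} [MeasurableSpace Z] {M : ParametricGAN dφ dθ n Z}
  {φs : EuclideanSpace ℝ (Fin dφ)} {θs : EuclideanSpace ℝ (Fin dθ)}

namespace Regular

/-- Real samples are counted as samples of the generator `θs`, so every part of the buffer
contributes a value of the same penalty function. -/
theorem discObjective_bufferLaw (hreg : M.Regular φs θs) (hθs : θs ∈ M.genManifold) (lam : ℝ)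
    {N : ℕ} (a : ℕ → ℝ≥0) (b : ℕ → Fin N → ℝ≥0) (θ : ℕ → EuclideanSpace ℝ (Fin dθ)) (t : ℕ)
    {φ : EuclideanSpace ℝ (Fin dφ)}
    (h0 : Integrable (fun z => M.D φ (M.G θs z) ^ 2) M.pz)
    (hj : ∀ j : Fin N, Integrable (fun z => M.D φ (M.G (θ (t - j)) z) ^ 2) M.pz) :
    M.discObjective lam (M.bufferLaw a b θ t) φ (θ t) =
      M.realLoss φ + M.fakeLoss M.h₂ (φ, θ t) - lam * (a t * M.fakeLoss (fun u => u ^ 2) (φ, θs) +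
        ∑ j : Fin N, b t j * M.fakeLoss (fun u => u ^ 2) (φ, θ (t - j))) := by
  have hsq : Measurable fun u : ℝ => u ^ 2 := measurable_id.pow_const 2
  have i0 : Integrable (fun x => M.D φ x ^ 2) M.p := by
    have := (hreg.integrable_genLaw_iff hsq φ θs).2 h0
    rwa [show M.genLaw θs = M.p from hθs] at this
  have ij : ∀ j : Fin N, Integrable (fun x => M.D φ x ^ 2) (M.genLaw (θ (t - j))) := fun j =>
    (hreg.integrable_genLaw_iff hsq φ _).2 (hj j)
  have e0 : ∫ x, M.D φ x ^ 2 ∂M.p = M.fakeLoss (fun u => u ^ 2) (φ, θs) :=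
    hreg.integral_p hsq φ hθs
  have ej : ∀ j : Fin N, ∫ x, M.D φ x ^ 2 ∂M.genLaw (θ (t - j)) =
      M.fakeLoss (fun u => u ^ 2) (φ, θ (t - j)) := fun j => hreg.integral_genLaw hsq φ _
  rw [discObjective, hreg.integral_genLaw hreg.measurable_h.2.1, bufferLaw, integral_add_measure
    i0.smul_measure_nnreal (integrable_finsetSum_measure.2 fun j _ => (ij j).smul_measure_nnreal),
    integral_finsetSum_measure fun j _ => (ij j).smul_measure_nnreal]
  simp only [integral_smul_nnreal_measure, e0, ej, NNReal.smul_def, smul_eq_mul]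
  rfl

theorem hasGradientAt_discObjective (hreg : M.Regular φs θs) (hθs : θs ∈ M.genManifold) (lam : ℝ)
    {N : ℕ} (a : ℕ → ℝ≥0) (b : ℕ → Fin N → ℝ≥0) (θ : ℕ → EuclideanSpace ℝ (Fin dθ)) (t : ℕ)
    {φ : EuclideanSpace ℝ (Fin dφ)}
    (h0 : ∀ᶠ φ' in 𝓝 φ, Integrable (fun z => M.D φ' (M.G θs z) ^ 2) M.pz)
    (hj : ∀ j : Fin N, ∀ᶠ φ' in 𝓝 φ, Integrable (fun z => M.D φ' (M.G (θ (t - j)) z) ^ 2) M.pz)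
    (d1 : DifferentiableAt ℝ M.realLoss φ) (d2 : DifferentiableAt ℝ (M.fakeLoss M.h₂) (φ, θ t))
    (s0 : DifferentiableAt ℝ (M.fakeLoss fun u => u ^ 2) (φ, θs))
    (sj : ∀ j : Fin N, DifferentiableAt ℝ (M.fakeLoss fun u => u ^ 2) (φ, θ (t - j))) :
    HasGradientAt (fun φ' => M.discObjective lam (M.bufferLaw a b θ t) φ' (θ t))
      (M.discField (φ, θ t) - lam • ((a t : ℝ) • M.penaltyField (φ, θs) +
        ∑ j : Fin N, (b t j : ℝ) • M.penaltyField (φ, θ (t - j)))) φ := by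
  have hd := (d1.hasFDerivAt.fun_add d2.hasFDerivAt.comp_prodMk_left).fun_sub
    (((s0.hasFDerivAt.comp_prodMk_left.const_mul (a t : ℝ)).fun_add (HasFDerivAt.fun_sum
      (u := Finset.univ) fun j _ =>
        (sj j).hasFDerivAt.comp_prodMk_left.const_mul (b t j : ℝ))).const_mul lam)
  have hg := (hd.congr_of_eventuallyEq (f₁ := fun φ' => M.discObjective lam
    (M.bufferLaw a b θ t) φ' (θ t)) (by
      filter_upwards [h0, eventually_all.2 hj] with φ' h0' hj'
      exact hreg.discObjective_bufferLaw hθs lam a b θ t h0' hj')).hasGradientAt_rieszVector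
  convert hg using 1
  simp only [discField, penaltyField, map_sub, map_smul, map_add, map_sum]

/-- Near the equilibrium the fields are those of the linearization in normal coordinates. -/
theorem eventually_field_estimates (hreg : M.Regular φs θs) (h1 : M.Realizable φs θs)
    (h3 : M.OutputConditions)
    {ξ ρ : EuclideanSpace ℝ (Fin dφ) → EuclideanSpace ℝ (Fin dφ)}
    {ζ σ : EuclideanSpace ℝ (Fin dθ) → EuclideanSpace ℝ (Fin dθ)}
    (hρ : Tendsto ρ (𝓝 φs) (𝓝 φs)) (hσ : Tendsto σ (𝓝 θs) (𝓝 θs))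
    (hρS : ∀ᶠ x in 𝓝 φs, ρ x ∈ M.discManifold) (hσS : ∀ᶠ x in 𝓝 θs, σ x ∈ M.genManifold)
    (hξ : (fun x => x - ρ x - ξ x) =o[𝓝 φs] ξ) (hζ : (fun x => x - σ x - ζ x) =o[𝓝 θs] ζ)
    {ε : ℝ} (hε : 0 < ε) :
    ∀ᶠ y in 𝓝 (φs, θs), ∀ h, ‖ξ y.1‖ ≤ h → ‖ζ y.2‖ ≤ h →
      ‖M.penaltyField y - (2 : ℝ) • M.discHess φs θs (ξ y.1)‖ ≤ ε * h ∧
      ‖M.discField y - ((iteratedDeriv 2 M.h₁ 0 + iteratedDeriv 2 M.h₂ 0) •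
        M.discHess φs θs (ξ y.1) - deriv M.h₁ 0 • M.coupling φs θs (ζ y.2))‖ ≤ ε * h ∧
      ‖M.genField y - deriv M.h₁ 0 • (M.coupling φs θs).adjoint (ξ y.1)‖ ≤ ε * h := by
  have hrt : Tendsto (fun y : EuclideanSpace ℝ (Fin dφ) × EuclideanSpace ℝ (Fin dθ) =>
      (ρ y.1, σ y.2)) (𝓝 (φs, θs)) (𝓝 (φs, θs)) :=
    (hρ.comp (continuous_fst.tendsto (φs, θs))).prodMk_nhds
      (hσ.comp (continuous_snd.tendsto (φs, θs)))
  have hrS : ∀ᶠ y : EuclideanSpace ℝ (Fin dφ) × EuclideanSpace ℝ (Fin dθ) in 𝓝 (φs, θs),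
      ρ y.1 ∈ M.discManifold ∧ σ y.2 ∈ M.genManifold :=
    ((continuous_fst.tendsto (φs, θs)).eventually hρS).and
      ((continuous_snd.tendsto (φs, θs)).eventually hσS)
  have hprod := isLittleO_normal_coordinate_prod hξ hζ
  have e1 := ((hreg.hasStrictFDerivAt_penaltyField h1).isLittleO_sub_normal_coordinate hrt (by
    filter_upwards [hrt.eventually hreg.penaltyField_eq_zero, hrS] with y hy hs
    exact hy hs.1 hs.2) hprod).def hε
  have e2 := ((hreg.hasStrictFDerivAt_discField h1 h3).isLittleO_sub_normal_coordinate hrt (by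
    filter_upwards [hrt.eventually (hreg.discField_eq_zero h1.1 h3), hrS] with y hy hs
    exact hy hs.1 hs.2) hprod).def hε
  have e3 := ((hreg.hasStrictFDerivAt_genField h1 h3).isLittleO_sub_normal_coordinate hrt (by
    filter_upwards [hrt.eventually hreg.genField_eq_zero, hrS] with y hy hs
    exact hy hs.1 hs.2) hprod).def hε
  filter_upwards [e1, e2, e3] with y h1 h2 h3 h hh1 hh2
  have hm : ε * ‖(ξ y.1, ζ y.2)‖ ≤ ε * h := by
    gcongr
    exact max_le hh1 hh2
  exact ⟨h1.trans hm, h2.trans hm, h3.trans hm⟩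

theorem eventually_differentiable (hreg : M.Regular φs θs) :
    ∀ᶠ y in 𝓝 (φs, θs), DifferentiableAt ℝ M.realLoss y.1 ∧
      DifferentiableAt ℝ (M.fakeLoss M.h₂) y ∧ DifferentiableAt ℝ (M.fakeLoss M.h₃) y ∧
      DifferentiableAt ℝ (M.fakeLoss fun u => u ^ 2) y ∧
      ∀ᶠ φ in 𝓝 y.1, Integrable (fun z => M.D φ (M.G y.2 z) ^ 2) M.pz := by
  filter_upwards [(continuous_fst.tendsto (φs, θs)).eventually hreg.dom_real.eventually_hasFDerivAt,
    (hreg.dom_fake M.h₂ (by simp)).eventually_hasFDerivAt,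
    (hreg.dom_fake M.h₃ (by simp)).eventually_hasFDerivAt,
    hreg.dom_sq.eventually_hasFDerivAt.eventually_nhds] with y y1 y2 y3 y4
  refine ⟨y1.2.1.differentiableAt, y2.2.1.differentiableAt, y3.2.1.differentiableAt,
    y4.self_of_nhds.2.1.differentiableAt, ?_⟩
  have hc : Tendsto (fun φ => (φ, y.2)) (𝓝 y.1) (𝓝 y) :=
    (continuous_id.prodMk continuous_const).tendsto y.1
  exact (hc.eventually y4).mono fun φ hφ => hφ.1

end Regular

end ParametricGAN

end

/-! ### Local convergence of the alternating scheme. -/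

theorem theorem1 {dφ dθ n : ℕ} {Z : Type*} [MeasurableSpace Z] (M : ParametricGAN dφ dθ n Z)
    (φs : EuclideanSpace ℝ (Fin dφ)) (θs : EuclideanSpace ℝ (Fin dθ))
    (hreg : M.Regular φs θs)
    (h1 : M.Realizable φs θs) (h2 : M.Nondegenerate φs θs) (h3 : M.OutputConditions)
    (lam : ℝ) (hlam : 0 < lam)
    (hlam' : iteratedDeriv 2 M.h₁ 0 + iteratedDeriv 2 M.h₂ 0 < 2 * lam) :
    ∃ η₀ : ℝ, 0 < η₀ ∧ ∀ η : ℝ, 0 < η → η < η₀ →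
      ∀ (N : ℕ) (a : ℕ → ℝ≥0) (b : ℕ → Fin N → ℝ≥0), (∀ t, a t + ∑ j, b t j = 1) →
        ∀ ε : ℝ, 0 < ε → ∃ δ : ℝ, 0 < δ ∧
          ∀ (φ : ℕ → EuclideanSpace ℝ (Fin dφ)) (θ : ℕ → EuclideanSpace ℝ (Fin dθ)),
            M.IsAlternatingGD lam η a b φ θ → dist (φ 0) φs < δ → dist (θ 0) θs < δ →
              (∀ t, dist (φ t) φs < ε ∧ dist (θ t) θs < ε) ∧
              ∃ φ' ∈ M.discManifold, ∃ θ' ∈ M.genManifold,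
                Tendsto φ atTop (𝓝 φ') ∧ Tendsto θ atTop (𝓝 θ') := by
  obtain ⟨⟨r₀, hr₀, hSφ, hSθ⟩, -⟩ := id h2
  have hTφ := hreg.mem_tangentVectors_discManifold_iff h1 h2
  have hTθ := hreg.mem_tangentVectors_genManifold_iff h2
  obtain ⟨ξ, ρ, hξm, hξd, hξ0, hξc, hρ, hρS, hξo, hξS⟩ :=
    hSφ.exists_normal_coordinate hr₀ h1.mem_discManifold _ hTφ
  obtain ⟨ζ, σ, hζm, hζd, hζ0, hζc, hσ, hσS, hζo, hζS⟩ :=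
    hSθ.exists_normal_coordinate hr₀ h1.1 _ hTθ
  set A := M.discHess φs θs
  set P := M.coupling φs θs
  set κ : ℝ := iteratedDeriv 2 M.h₁ 0 + iteratedDeriv 2 M.h₂ 0
  set c : ℝ := deriv M.h₁ 0
  have hA : ∀ v, inner ℝ (A v) v = 0 → A v = 0 := fun v hv =>
    (hTφ v).1 (hreg.mem_tangentVectors_discManifold_of_inner_eq_zero h1 h2 hv)
  obtain ⟨η₀, hη₀, hmain⟩ := exists_step_size_of_saddle A P (μ := 2 * lam - κ) (c := c)
    (sub_pos.2 hlam') h3.1 (hreg.discHess_nonneg h1) hA (hreg.discHess_symm h1)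
    (hreg.inner_coupling_eq_zero h1 h2) hξm hζm hξd hζd hξ0 hζ0 hξc hζc hξS hζS
  refine ⟨η₀, hη₀, fun η hη hηη N a b hab => hmain η hη hηη N (M.IsAlternatingGD lam η a b) ?_⟩
  intro ε hε
  -- The discriminator field contributes one error `ε'` and the penalty, multiplied by `lam`,
  -- another.
  have hε' : 0 < ε / (1 + |lam|) := by positivity
  set ε' := ε / (1 + |lam|)
  have hεε : ε' + |lam| * ε' = ε := by simp only [ε']; field_simp
  have hε'ε : ε' ≤ ε := by
    rw [← hεε]
    exact le_add_of_nonneg_right (by positivity)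
  have hev := (hreg.eventually_field_estimates h1 h3 hρ hσ hρS hσS hξo hζo hε').and
    hreg.eventually_differentiable
  obtain ⟨r, hr, hev⟩ := Metric.eventually_nhds_iff.1 hev
  have hev' : ∀ x y, dist x φs < r → dist y θs < r → _ := fun x y hx hy =>
    @hev (x, y) (max_lt hx hy)
  refine ⟨r, hr, fun φ θ hR t ht => ?_⟩
  obtain ⟨hφ1, hθ1⟩ := hR t
  have hθs : dist θs θs < r := by simpa using hr
  have hj : ∀ j : ℕ, dist (θ (t - j)) θs < r := fun j => (ht _ (Nat.sub_le _ _)).2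
  have hφt := (ht t le_rfl).1
  have hst := hev' (φ t) (θ t) hφt (ht t le_rfl).2
  have hss := hev' (φ t) θs hφt hθs
  have hsj := fun j : ℕ => hev' (φ t) (θ (t - j)) hφt (hj j)
  constructor
  · have hX := hreg.hasGradientAt_discObjective h1.1 lam a b θ t (φ := φ t) hss.2.2.2.2.2
      (fun j => (hsj j).2.2.2.2.2) hst.2.1 hst.2.2.1 hss.2.2.2.2.1 (fun j => (hsj j).2.2.2.2.1)
    refine ⟨_, by rw [hφ1, hX.gradient], fun h hh1 hh2 => ?_⟩
    have hh0 : 0 ≤ h := (norm_nonneg _).trans hh1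
    have E0 := (hst.1 h hh1 (hh2 0 (Nat.zero_le _))).2.1
    -- The real part of the buffer sits at `θs`, where `ζ` is zero, so any admissible `h` bounds it.
    have Es := (hss.1 h hh1 (by simpa [hζ0] using hh0)).1
    have Ej := fun j : Fin N => ((hsj j).1 h hh1 (hh2 j j.2.le)).1
    have hab' : (a t : ℝ) + ∑ j, (b t j : ℝ) = 1 := by exact_mod_cast hab t
    -- The common linear part of all penalty terms. As the weights sum to 1, the mixture has the
    -- same linear part, and its error is a convex combination of the individual ones.
    set w := (2 : ℝ) • A (ξ (φ t))
    have hw : (a t : ℝ) • w + ∑ j, (b t j : ℝ) • w = w := by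
      rw [← Finset.sum_smul, ← add_smul, hab', one_smul]
    have hpen : ‖(a t : ℝ) • M.penaltyField (φ t, θs) +
        ∑ j : Fin N, (b t j : ℝ) • M.penaltyField (φ t, θ (t - j)) - w‖ ≤ ε' * h := by
      have e : (a t : ℝ) • M.penaltyField (φ t, θs) +
          ∑ j : Fin N, (b t j : ℝ) • M.penaltyField (φ t, θ (t - j)) - w =
          (a t : ℝ) • (M.penaltyField (φ t, θs) - w) +
          ∑ j : Fin N, (b t j : ℝ) • (M.penaltyField (φ t, θ (t - j)) - w) := by
        conv_lhs => rw [← hw]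
        simp only [smul_sub, Finset.sum_sub_distrib]
        abel
      rw [e]
      calc _ ≤ (a t : ℝ) * (ε' * h) + ∑ j : Fin N, (b t j : ℝ) * (ε' * h) := by
            refine (norm_add_le _ _).trans (add_le_add ?_ ((norm_sum_le _ _).trans
              (Finset.sum_le_sum fun j _ => ?_)))
            · rw [norm_smul, Real.norm_of_nonneg (NNReal.coe_nonneg _)]
              gcongr
            · rw [norm_smul, Real.norm_of_nonneg (NNReal.coe_nonneg _)]
              gcongr
              exact Ej j
        _ = ε' * h := by rw [← Finset.sum_mul, ← add_mul, hab', one_mul]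
    have e : M.discField (φ t, θ t) - lam • ((a t : ℝ) • M.penaltyField (φ t, θs) +
        ∑ j : Fin N, (b t j : ℝ) • M.penaltyField (φ t, θ (t - j))) -
        -((2 * lam - κ) • A (ξ (φ t)) + c • P (ζ (θ t))) =
        (M.discField (φ t, θ t) - (κ • A (ξ (φ t)) - c • P (ζ (θ t)))) -
        lam • ((a t : ℝ) • M.penaltyField (φ t, θs) +
          ∑ j : Fin N, (b t j : ℝ) • M.penaltyField (φ t, θ (t - j)) - w) := by
      simp only [w]
      module
    rw [e, ← hεε, add_mul, mul_assoc]
    refine (norm_sub_le _ _).trans (add_le_add E0 ?_)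
    rw [norm_smul, Real.norm_eq_abs]
    gcongr
  · intro hφ'
    have hst' := hev' (φ (t + 1)) (θ t) hφ' (ht t le_rfl).2
    have hY := hst'.2.2.2.1.hasFDerivAt.comp_prodMk_right.hasGradientAt_rieszVector
    have hY' : gradient (fun θ' => M.genObjective (φ (t + 1)) θ') (θ t) =
      M.genField (φ (t + 1), θ t) := hY.gradient
    refine ⟨_, by rw [hθ1, hY'], fun h hh1 hh2 => ?_⟩
    exact (hst'.1 h hh1 hh2).2.2.trans (by
      have : 0 ≤ h := (norm_nonneg _).trans hh1
      gcongr)
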